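/- For every real number $c>0$ and all integers $M>m\ge 2$ there exist constants $\alpha,\beta>0$ and an integer $N$ (depending only on $c,m,M$) with the following property. Let $G$ be a finite simple graph with $n\ge N$ vertices, at least $c\,n^{1+1/m}$ edges and girth greater than $2m$ (that is, $G$ contains no cycle of length at most $2m$). Then for every integer $\ell$ with $m+1\le \ell\le M$, the number of cycles of length $2\ell$ in $G$ (counted as subgraphs) is at least $\alpha\, n^{2\ell/m}$ and at most $\beta\, n^{2\ell/m}$. In particular, the number of $2\ell$-cycles in such graphs is $\Theta(n^{2\ell/m})$. -/

import Mathlib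

/-!
# Even cycles in dense graphs of large girth

Let `G` have `n` vertices, at least `c * n ^ (1 + 1 / m)` edges and girth larger than `2 * m`. Both
bounds on the number of `2ℓ`-cycles rest on one fact (`Walk.eq_of_isChain_edges`): a
non-backtracking walk of length at most `m` is determined by its endpoints, since two such walks
span a graph with at most `2 * m` edges, which is a forest.

**Upper bound** (`copyCount_cycleGraph_le`, with constant `1` and without the assumption on the
number of edges). Take a uniformly random labelled `2ℓ`-cycle and let `h k` be the entropy of an arc
of `k` steps, averaged over the rotations. By submodularity `h` is concave. The ends of an arc of
`m` steps determine it, so `h m ≤ 2 * h 0` and `h 0 ≤ log n`; hence each step beyond the `m`-th adds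
at most `(h m - h 0) / m ≤ log n / m`. An arc of `2ℓ - m` steps leaves out the interior of an arc of
`m` steps and so determines the whole cycle, whose entropy is therefore at most
`2 * log n + (2ℓ - 2m) * log n / m = (2ℓ / m) * log n`. The maximum degree does not enter.

**Lower bound** (`exists_mul_rpow_le_copyCount`). Put `D = n ^ (1 / m)`. A Moore-type bound shows
that few edges touch vertices of degree at least `K * D` when `K` is large, so that some subgraph
`H` on a positive proportion of the vertices has all its degrees of order `D`
(`exists_almost_regular_subgraph`). By the Cauchy–Schwarz inequality `H` has at least a constant
times `D ^ (2ℓ)` closed walks of length `2ℓ` (`le_card_closedWalks`). A closed walk that repeats a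
vertex splits into two shorter closed walks through that vertex, and counting walks with given ends
according to their backtracking (`numWalks_le`) shows that there are only `O(D ^ (2ℓ - 1 / 2))` of
these. The remaining closed walks are labelled cycles.
-/

namespace SimpleGraph

variable {V : Type*} {G : SimpleGraph V}

/-! ### Non-backtracking walks and the Moore bound -/

/-- In a graph of girth larger than `2 * m`, a non-backtracking walk of length at most `m` is
determined by its endpoints. -/
lemma Walk.eq_of_isChain_edges {m : ℕ} (hG : ((2 * m : ℕ) : ℕ∞) < G.egirth) {x y : V}
    {p q : G.Walk x y} (hp : p.edges.IsChain (· ≠ ·)) (hq : q.edges.IsChain (· ≠ ·))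
    (hpm : p.length ≤ m) (hqm : q.length ≤ m) : p = q := by
  classical
  -- The edges of the two walks span a graph with at most `2 * m` edges, hence a forest.
  let H : SimpleGraph V := fromEdgeSet {e | e ∈ p.edges ++ q.edges}
  have hmem : ∀ e, e ∈ p.edges ++ q.edges → e ∈ G.edgeSet := by
    intro e he
    rcases List.mem_append.1 he with h | h
    · exact p.edges_subset_edgeSet h
    · exact q.edges_subset_edgeSet h
  have hHG : H ≤ G := by
    intro a b hab
    exact hmem _ ((fromEdgeSet_adj _).1 hab).1
  have hH : ∀ e, e ∈ p.edges ++ q.edges → e ∈ H.edgeSet := by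
    intro e he
    have : e ∈ G.edgeSet := hmem e he
    simp only [H, edgeSet_fromEdgeSet]
    exact ⟨he, G.not_isDiag_of_mem_edgeSet this⟩
  have hac : H.IsAcyclic := by
    intro v w hw
    have h1 : G.egirth ≤ (w.mapLe hHG).length := egirth_le_length (hw.mapLe hHG)
    have h2 : w.length ≤ 2 * m := by
      have hsub : w.edges ⊆ p.edges ++ q.edges := by
        intro e he
        have := w.edges_subset_edgeSet he
        simp only [H, edgeSet_fromEdgeSet] at this
        exact this.1
      have := (hw.isTrail.edges_nodup.subperm hsub).length_le
      simp only [List.length_append, Walk.length_edges] at this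
      omega
    simp only [Walk.mapLe, Walk.length_map] at h1
    have := lt_of_lt_of_le hG h1
    have : 2 * m < w.length := by exact_mod_cast this
    omega
  have hp' : ∀ e ∈ p.edges, e ∈ H.edgeSet := fun e he ↦ hH e (List.mem_append_left _ he)
  have hq' : ∀ e ∈ q.edges, e ∈ H.edgeSet := fun e he ↦ hH e (List.mem_append_right _ he)
  have h1 : (p.transfer H hp').IsPath := (hac.isPath_iff_isChain _).2 (by simpa using hp)
  have h2 : (q.transfer H hq').IsPath := (hac.isPath_iff_isChain _).2 (by simpa using hq)
  have h3 : p.transfer H hp' = q.transfer H hq' :=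
    congrArg Subtype.val ((hac.subsingleton_path x y).elim ⟨_, h1⟩ ⟨_, h2⟩)
  have h4 := congrArg Walk.support h3
  rw [Walk.support_transfer, Walk.support_transfer] at h4
  exact Walk.ext_support h4

/-- Greedy construction of non-backtracking walks of length `k` from `v` that do not start with
the edge `s(u, v)`. -/
lemma exists_finset_walk_of_le_degree [Fintype V] [DecidableRel G.Adj] {S : Finset V} {δ : ℕ}
    (hdeg : ∀ v ∈ S, δ + 1 ≤ G.degree v) (hS : ∀ v ∈ S, ∀ w, G.Adj v w → w ∈ S) (k : ℕ) :
    ∀ u v, v ∈ S → ∃ T : Finset (Σ y, G.Walk v y), δ ^ k ≤ T.card ∧ ∀ t ∈ T, t.1 ∈ S ∧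
      t.2.length = k ∧ (s(u, v) :: t.2.edges).IsChain (· ≠ ·) := by
  classical
  induction k with
  | zero =>
    intro u v hv
    refine ⟨{⟨v, .nil⟩}, by simp, ?_⟩
    intro t ht
    rw [Finset.mem_singleton] at ht
    subst ht
    simpa using hv
  | succ k ih =>
    intro u v hv
    choose! T hT1 hT2 using fun (w : V) (hw : w ∈ S) ↦ ih v w hw
    have hadj : ∀ w : G.neighborSet v, G.Adj v w.1 := fun w ↦ w.2
    have hext : ∀ w : G.neighborSet v, ∃ e : (Σ y, G.Walk w.1 y) ↪ (Σ y, G.Walk v y),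
        ∀ t, e t = ⟨t.1, Walk.cons (hadj w) t.2⟩ := fun w ↦
      ⟨⟨fun t ↦ ⟨t.1, Walk.cons (hadj w) t.2⟩, by
        rintro ⟨a, p⟩ ⟨b, q⟩ h
        simp only [Sigma.mk.injEq] at h
        obtain ⟨rfl, h⟩ := h
        simpa using h⟩, fun _ ↦ rfl⟩
    choose ext hext using hext
    let N : Finset (G.neighborSet v) := Finset.univ.filter fun w ↦ w.1 ≠ u
    have hN : δ ≤ N.card := by
      have h1 : (Finset.univ : Finset (G.neighborSet v)).card = G.degree v := by
        rw [Finset.card_univ, card_neighborSet_eq_degree]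
      have h2 : (Finset.univ.filter fun w : G.neighborSet v ↦ ¬ w.1 ≠ u).card ≤ 1 := by
        rw [Finset.card_le_one]
        intro a ha b hb
        simp only [ne_eq, not_not, Finset.mem_filter, Finset.mem_univ, true_and] at ha hb
        exact Subtype.ext (ha.trans hb.symm)
      have h3 := Finset.card_filter_add_card_filter_not (s := (Finset.univ : Finset (G.neighborSet v)))
        (fun w ↦ w.1 ≠ u)
      have := hdeg v hv
      simp only [N]
      omega
    refine ⟨N.biUnion fun w ↦ (T w.1).map (ext w), ?_, ?_⟩
    · rw [Finset.card_biUnion]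
      · calc δ ^ (k + 1) = δ * δ ^ k := by ring
          _ ≤ N.card * δ ^ k := by gcongr
          _ ≤ _ := by
            rw [← smul_eq_mul, ← Finset.sum_const]
            refine Finset.sum_le_sum fun w _ ↦ ?_
            rw [Finset.card_map]
            exact hT1 _ (hS v hv _ w.2)
      · intro a _ b _ hab
        rw [Function.onFun, Finset.disjoint_left]
        intro t ha hb
        simp only [Finset.mem_map] at ha hb
        obtain ⟨⟨y, p⟩, -, rfl⟩ := ha
        obtain ⟨⟨z, q⟩, -, h⟩ := hb
        simp only [hext, Sigma.mk.injEq] at h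
        obtain ⟨rfl, h⟩ := h
        have h := congrArg Walk.support (eq_of_heq h)
        have h := congrArg (fun l ↦ l.tail.head?) h
        apply hab
        have h5 : ∀ {a b : V} (p : G.Walk a b), p.support.head? = some a := by
          intro a b p; cases p <;> rfl
        simp only [Walk.support_cons, List.tail_cons, h5, Option.some.injEq] at h
        exact Subtype.ext h.symm
    · intro t ht
      simp only [Finset.mem_biUnion, Finset.mem_map] at ht
      obtain ⟨w, hw, t, ht, rfl⟩ := ht
      obtain ⟨h1, h2, h3⟩ := hT2 w.1 (hS v hv _ w.2) t ht
      rw [hext]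
      refine ⟨h1, by simp [h2], ?_⟩
      rw [Walk.edges_cons]
      refine List.IsChain.cons_cons ?_ h3
      intro h
      have hw' : w.1 ≠ u := by simpa [N] using hw
      have hvw : G.Adj v w.1 := hadj w
      rw [Sym2.eq_iff] at h
      rcases h with ⟨rfl, h⟩ | ⟨h, -⟩
      · exact hvw.ne h
      · exact hw' h.symm

/-- A form of the Moore bound: if every degree in the closed set `S` exceeds `δ` and the girth
exceeds `2 * (k + 1)`, then the ball of radius `k + 1` around `v ∈ S` already shows that `S` has at
least `G.degree v * δ ^ k` elements. -/
lemma degree_mul_pow_le_card [Fintype V] [DecidableRel G.Adj] {S : Finset V} {δ k : ℕ}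
    (hG : ((2 * (k + 1) : ℕ) : ℕ∞) < G.egirth)
    (hdeg : ∀ v ∈ S, δ + 1 ≤ G.degree v) (hS : ∀ v ∈ S, ∀ w, G.Adj v w → w ∈ S)
    {v : V} (hv : v ∈ S) : G.degree v * δ ^ k ≤ S.card := by
  classical
  choose! T hT1 hT2 using fun (w : V) (hw : w ∈ S) ↦
    exists_finset_walk_of_le_degree hdeg hS k v w hw
  let D : Finset (Σ w : G.neighborSet v, Σ y, G.Walk w.1 y) := Finset.univ.sigma fun w ↦ T w.1
  have hD : G.degree v * δ ^ k ≤ D.card := by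
    rw [Finset.card_sigma, ← card_neighborSet_eq_degree, ← Finset.card_univ, ← smul_eq_mul,
      ← Finset.sum_const]
    exact Finset.sum_le_sum fun w _ ↦ hT1 _ (hS v hv _ w.2)
  have hadj : ∀ w : G.neighborSet v, G.Adj v w.1 := fun w ↦ w.2
  refine hD.trans (Finset.card_le_card_of_injOn (fun t ↦ t.2.1) ?_ ?_)
  · rintro ⟨w, t⟩ ht
    have ht : t ∈ T w.1 := by simpa [D] using ht
    exact (hT2 w.1 (hS v hv _ w.2) t ht).1
  · rintro ⟨w, y, p⟩ ht ⟨w', y', p'⟩ ht' (rfl : y = y')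
    have ht : ⟨y, p⟩ ∈ T w.1 := by simpa [D] using ht
    have ht' : ⟨y, p'⟩ ∈ T w'.1 := by simpa [D] using ht'
    obtain ⟨-, h2, h3⟩ := hT2 w.1 (hS v hv _ w.2) _ ht
    obtain ⟨-, h2', h3'⟩ := hT2 w'.1 (hS v hv _ w'.2) _ ht'
    have := Walk.eq_of_isChain_edges hG (p := Walk.cons (hadj w) p)
      (q := Walk.cons (hadj w') p')
      (by simpa using h3) (by simpa using h3') (by simpa using h2.le) (by simpa using h2'.le)
    obtain ⟨w, hw⟩ := w
    obtain ⟨w', hw'⟩ := w'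
    cases this
    rfl

end SimpleGraph

/-! ### Entropy of coordinate projections -/

section Entropy

open Finset Real

variable {ι V : Type*} [DecidableEq V]

/-- The number of members of `S` that agree with `x` on the coordinates in `I`. -/
def agreeCard (S : Finset (ι → V)) (I : Finset ι) (x : ι → V) : ℕ :=
  #{y ∈ S | ∀ i ∈ I, y i = x i}

/-- The Shannon entropy of the projection to the coordinates in `I` of a uniformly random member of
`S`, multiplied by `#S` to avoid a division. -/
noncomputable def coordEntropy (S : Finset (ι → V)) (I : Finset ι) : ℝ :=
  ∑ x ∈ S, (log #S - log (agreeCard S I x))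

variable {S : Finset (ι → V)} {I J K : Finset ι}

lemma agreeCard_pos {x : ι → V} (hx : x ∈ S) : 0 < agreeCard S I x :=
  card_pos.2 ⟨x, by simp [hx]⟩

lemma agreeCard_congr {x y : ι → V} (h : ∀ i ∈ I, y i = x i) :
    agreeCard S I y = agreeCard S I x := by
  unfold agreeCard
  congr 1
  refine filter_congr fun z _ ↦ forall₂_congr fun i hi ↦ by rw [h i hi]

/-- If the coordinates in `I` determine those in `J` within `S`, projecting to `I` carries at least
as much entropy as projecting to `J`. -/
lemma coordEntropy_le_of_determines
    (h : ∀ x ∈ S, ∀ y ∈ S, (∀ i ∈ I, y i = x i) → ∀ j ∈ J, y j = x j) :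
    coordEntropy S J ≤ coordEntropy S I := by
  refine sum_le_sum fun x hx ↦ ?_
  have h1 : agreeCard S I x ≤ agreeCard S J x :=
    card_le_card fun y hy ↦ by
      rw [mem_filter] at hy ⊢
      exact ⟨hy.1, h x hx y hy.1 hy.2⟩
  have : log (agreeCard S I x) ≤ log (agreeCard S J x) :=
    log_le_log (by exact_mod_cast agreeCard_pos hx) (by exact_mod_cast h1)
  linarith

lemma coordEntropy_eq_of_determines
    (h : ∀ x ∈ S, ∀ y ∈ S, (∀ i ∈ I, y i = x i) → y = x) :
    coordEntropy S I = #S * log #S := by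
  have : ∀ x ∈ S, log #S - log (agreeCard S I x) = log #S := by
    intro x hx
    have : agreeCard S I x = 1 := by
      refine card_eq_one.2 ⟨x, ?_⟩
      ext y
      simp only [mem_filter, mem_singleton]
      exact ⟨fun hy ↦ h x hx y hy.1 hy.2, fun hy ↦ by simp [hy, hx]⟩
    simp [this]
  rw [coordEntropy, sum_congr rfl this, sum_const, nsmul_eq_mul]

lemma coordEntropy_empty : coordEntropy S ∅ = 0 := by
  simp [coordEntropy, agreeCard]

lemma coordEntropy_singleton_le [Fintype V] (i : ι) :
    coordEntropy S {i} ≤ #S * log (Fintype.card V) := by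
  have hpos : ∀ x : ι → V, x ∈ S → (0 : ℝ) < agreeCard S {i} x :=
    fun x hx ↦ by exact_mod_cast agreeCard_pos hx
  rcases S.eq_empty_or_nonempty with rfl | ⟨x₀, hx₀⟩
  · simp [coordEntropy]
  have hV : (0 : ℝ) < Fintype.card V := by
    exact_mod_cast Fintype.card_pos_iff.2 ⟨x₀ i⟩
  have hS : (0 : ℝ) < #S := by exact_mod_cast card_pos.2 ⟨x₀, hx₀⟩
  have h1 : ∑ x ∈ S, (agreeCard S {i} x : ℝ)⁻¹ ≤ Fintype.card V := by
    calc ∑ x ∈ S, (agreeCard S {i} x : ℝ)⁻¹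
        = ∑ v : V, ∑ x ∈ S with x i = v, (agreeCard S {i} x : ℝ)⁻¹ := by
          rw [sum_fiberwise]
      _ ≤ ∑ v : V, 1 := by
          refine sum_le_sum fun v _ ↦ ?_
          have h2 : ∀ x ∈ S.filter (fun x ↦ x i = v), (agreeCard S {i} x : ℝ)⁻¹ =
              (#(S.filter (fun x ↦ x i = v)) : ℝ)⁻¹ := by
            intro x hx
            rw [mem_filter] at hx
            simp [agreeCard, hx.2]
          rw [sum_congr rfl h2, sum_const, nsmul_eq_mul]
          exact mul_inv_le_one
      _ = Fintype.card V := by simp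
  calc coordEntropy S {i}
      ≤ ∑ x ∈ S, (log (Fintype.card V) +
          (#S * (agreeCard S {i} x : ℝ)⁻¹ / Fintype.card V - 1)) := by
        refine sum_le_sum fun x hx ↦ ?_
        have h3 := hpos x hx
        have := log_le_sub_one_of_pos
          (show (0 : ℝ) < #S * (agreeCard S {i} x : ℝ)⁻¹ / Fintype.card V by positivity)
        rw [log_div (by positivity) hV.ne', log_mul hS.ne' (by positivity), log_inv] at this
        linarith
    _ = #S * log (Fintype.card V) +
          (#S * ((∑ x ∈ S, (agreeCard S {i} x : ℝ)⁻¹) / Fintype.card V) - #S) := by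
        rw [sum_add_distrib, sum_sub_distrib, ← sum_div, ← mul_sum]
        simp
        ring
    _ ≤ #S * log (Fintype.card V) := by
        have : (∑ x ∈ S, (agreeCard S {i} x : ℝ)⁻¹) / Fintype.card V ≤ 1 := (div_le_one hV).2 h1
        nlinarith

variable [DecidableEq ι]

/-- Double counting behind submodularity: `I` and `J` are conditionally independent given `K` under
the weights on the left-hand side. -/
lemma sum_agreeCard_div_le (hI : K ⊆ I) (hJ : K ⊆ J) :
    ∑ x ∈ S, ((agreeCard S I x : ℝ) * agreeCard S J x) /
      (agreeCard S (I ∪ J) x * agreeCard S K x) ≤ #S := by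
  classical
  have hpos : ∀ (L : Finset ι) (x : ι → V), x ∈ S → (0 : ℝ) < agreeCard S L x :=
    fun L x hx ↦ by exact_mod_cast agreeCard_pos hx
  calc ∑ x ∈ S, ((agreeCard S I x : ℝ) * agreeCard S J x) /
      (agreeCard S (I ∪ J) x * agreeCard S K x)
      = ∑ x ∈ S, ∑ y ∈ S, ∑ z ∈ S, if (∀ i ∈ I, y i = x i) ∧ (∀ i ∈ J, z i = x i) then
          ((agreeCard S (I ∪ J) x : ℝ) * agreeCard S K x)⁻¹ else 0 := by
        refine sum_congr rfl fun x _ ↦ ?_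
        have hite : ∀ (P Q : Prop) [Decidable P] [Decidable Q] (c : ℝ), (if P ∧ Q then c else 0) =
            (if P then 1 else 0) * ((if Q then 1 else 0) * c) := by
          intro P Q _ _ c
          by_cases hP : P <;> by_cases hQ : Q <;> simp [hP, hQ]
        simp_rw [hite, ← mul_sum, ← sum_mul, sum_boole]
        rw [div_eq_mul_inv, mul_assoc]
        rfl
    _ = ∑ y ∈ S, ∑ z ∈ S, ∑ x ∈ S, if (∀ i ∈ I, y i = x i) ∧ (∀ i ∈ J, z i = x i) then
          ((agreeCard S (I ∪ J) x : ℝ) * agreeCard S K x)⁻¹ else 0 := by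
        rw [sum_comm]
        exact sum_congr rfl fun y _ ↦ sum_comm
    _ ≤ ∑ y ∈ S, ∑ z ∈ S, if (∀ i ∈ K, z i = y i) then (agreeCard S K y : ℝ)⁻¹ else 0 := by
        refine sum_le_sum fun y hy ↦ sum_le_sum fun z hz ↦ ?_
        by_cases hx : ∃ x ∈ S, (∀ i ∈ I, y i = x i) ∧ (∀ i ∈ J, z i = x i)
        · obtain ⟨x, hxS, hxI, hxJ⟩ := hx
          rw [if_pos fun i hi ↦ (hxJ i (hJ hi)).trans (hxI i (hI hi)).symm, ← sum_filter]
          have h1 : ∀ w ∈ S.filter (fun w ↦ (∀ i ∈ I, y i = w i) ∧ (∀ i ∈ J, z i = w i)),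
              ((agreeCard S (I ∪ J) w : ℝ) * agreeCard S K w)⁻¹ =
              ((agreeCard S (I ∪ J) x : ℝ) * agreeCard S K y)⁻¹ := by
            intro w hw
            rw [mem_filter] at hw
            rw [agreeCard_congr (x := x) (y := w) (I := I ∪ J), agreeCard_congr (x := y) (y := w)
              (I := K)]
            · exact fun i hi ↦ (hw.2.1 i (hI hi)).symm
            · intro i hi
              rcases mem_union.1 hi with hi | hi
              · rw [← hw.2.1 i hi, hxI i hi]
              · rw [← hw.2.2 i hi, hxJ i hi]
          rw [sum_congr rfl h1, sum_const, nsmul_eq_mul]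
          have h2 : (#(S.filter (fun w ↦ (∀ i ∈ I, y i = w i) ∧ (∀ i ∈ J, z i = w i))) : ℝ) =
              agreeCard S (I ∪ J) x := by
            unfold agreeCard
            congr 2
            refine filter_congr fun w _ ↦ ?_
            constructor
            · rintro ⟨h, h'⟩ i hi
              rcases mem_union.1 hi with hi | hi
              · rw [← h i hi, hxI i hi]
              · rw [← h' i hi, hxJ i hi]
            · intro h
              exact ⟨fun i hi ↦ by rw [h i (mem_union_left _ hi), hxI i hi],
                fun i hi ↦ by rw [h i (mem_union_right _ hi), hxJ i hi]⟩
          rw [h2, mul_inv, ← mul_assoc, mul_inv_cancel₀ (hpos _ x hxS).ne', one_mul]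
        · rw [sum_eq_zero]
          · split_ifs <;> positivity
          · intro x hxS
            rw [if_neg fun h ↦ hx ⟨x, hxS, h⟩]
    _ = ∑ y ∈ S, 1 := by
        refine sum_congr rfl fun y hy ↦ ?_
        rw [← sum_filter, sum_const, nsmul_eq_mul]
        exact mul_inv_cancel₀ (hpos K y hy).ne'
    _ = #S := by simp

/-- Submodularity of entropy. -/
lemma coordEntropy_union_add_le (hI : K ⊆ I) (hJ : K ⊆ J) :
    coordEntropy S (I ∪ J) + coordEntropy S K ≤ coordEntropy S I + coordEntropy S J := by
  have hpos : ∀ (L : Finset ι) (x : ι → V), x ∈ S → (0 : ℝ) < agreeCard S L x :=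
    fun L x hx ↦ by exact_mod_cast agreeCard_pos hx
  suffices h : ∑ x ∈ S, (log (agreeCard S I x) + log (agreeCard S J x)
      - log (agreeCard S (I ∪ J) x) - log (agreeCard S K x)) ≤ 0 by
    simp only [coordEntropy, sum_sub_distrib, sum_add_distrib] at h ⊢
    linarith
  calc ∑ x ∈ S, (log (agreeCard S I x) + log (agreeCard S J x)
      - log (agreeCard S (I ∪ J) x) - log (agreeCard S K x))
      ≤ ∑ x ∈ S, (((agreeCard S I x : ℝ) * agreeCard S J x) /
        (agreeCard S (I ∪ J) x * agreeCard S K x) - 1) := by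
        refine sum_le_sum fun x hx ↦ ?_
        have h1 := hpos I x hx
        have h2 := hpos J x hx
        have h3 := hpos (I ∪ J) x hx
        have h4 := hpos K x hx
        refine le_trans (le_of_eq ?_) (log_le_sub_one_of_pos (by positivity))
        rw [log_div (by positivity) (by positivity), log_mul h1.ne' h2.ne', log_mul h3.ne' h4.ne']
        ring
    _ ≤ 0 := by
        rw [sum_sub_distrib]
        have := sum_agreeCard_div_le (S := S) hI hJ
        simp only [sum_const, nsmul_eq_mul, mul_one]
        linarith

lemma coordEntropy_pair_le (i j : ι) :
    coordEntropy S {i, j} ≤ coordEntropy S {i} + coordEntropy S {j} := by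
  have := coordEntropy_union_add_le (S := S) (I := {i}) (J := {j}) (K := ∅) (by simp) (by simp)
  rw [coordEntropy_empty, add_zero] at this
  exact this

end Entropy

/-! ### Counting cyclic sequences -/

section Cyclic

open Finset Real

variable {A V : Type*} [AddCommGroup A] [DecidableEq A] [DecidableEq V]

/-- The arc `i, i + g, …, i + k • g` in the cyclic order generated by `g`. -/
def arc (g i : A) (k : ℕ) : Finset A := (range (k + 1)).image fun j ↦ i + j • g

lemma mem_arc {g i a : A} {k : ℕ} : a ∈ arc g i k ↔ ∃ j ≤ k, i + j • g = a := by
  simp [arc]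

variable [Fintype A]

/-- The entropy of an arc of `k` steps, summed over all of its rotations. -/
noncomputable def arcEntropy (S : Finset (A → V)) (g : A) (k : ℕ) : ℝ :=
  ∑ i, coordEntropy S (arc g i k)

/-- The entropy increments of growing arcs decrease. -/
lemma arcEntropy_add_le (S : Finset (A → V)) (g : A) (k : ℕ) :
    arcEntropy S g (k + 2) + arcEntropy S g k ≤ 2 * arcEntropy S g (k + 1) := by
  have hshift : ∀ k, arcEntropy S g k = ∑ i, coordEntropy S (arc g (i + g) k) := fun k ↦
    (Equiv.sum_comp (Equiv.addRight g) fun i ↦ coordEntropy S (arc g i k)).symm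
  rw [two_mul]
  nth_rewrite 4 [hshift]
  nth_rewrite 2 [hshift]
  simp only [arcEntropy]
  rw [← sum_add_distrib, ← sum_add_distrib]
  refine sum_le_sum fun i _ ↦ ?_
  have h1 : arc g i (k + 2) = arc g i (k + 1) ∪ arc g (i + g) (k + 1) := by
    ext a
    simp only [mem_union, mem_arc]
    constructor
    · rintro ⟨j, hj, rfl⟩
      rcases Nat.lt_or_ge j (k + 2) with h | h
      · exact Or.inl ⟨j, by omega, rfl⟩
      · refine Or.inr ⟨j - 1, by omega, ?_⟩
        obtain ⟨j, rfl⟩ : ∃ j', j = j' + 1 := ⟨j - 1, by omega⟩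
        simp only [Nat.add_sub_cancel, succ_nsmul]
        abel
    · rintro (⟨j, hj, rfl⟩ | ⟨j, hj, rfl⟩)
      · exact ⟨j, by omega, rfl⟩
      · exact ⟨j + 1, by omega, by rw [succ_nsmul]; abel⟩
  rw [h1]
  refine coordEntropy_union_add_le ?_ ?_
  · intro a
    simp only [mem_arc]
    rintro ⟨j, hj, rfl⟩
    exact ⟨j + 1, by omega, by rw [succ_nsmul]; abel⟩
  · intro a
    simp only [mem_arc]
    rintro ⟨j, hj, rfl⟩
    exact ⟨j, by omega, rfl⟩

/-- If `h` is concave, extrapolating the chord over `[0, m]` bounds `h` beyond `m`. -/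
lemma le_chord_of_concave {h : ℕ → ℝ} (hc : ∀ k, h (k + 2) + h k ≤ 2 * h (k + 1)) {m : ℕ}
    (hm : 0 < m) (t : ℕ) : h (m + t) ≤ h m + t * ((h m - h 0) / m) := by
  have hanti : Antitone fun k ↦ h (k + 1) - h k :=
    antitone_nat_of_succ_le fun k ↦ by have := hc k; linarith
  have hinc : ∀ k, m ≤ k → h (k + 1) - h k ≤ (h m - h 0) / m := by
    intro k hk
    rw [le_div_iff₀ (by exact_mod_cast hm)]
    calc (h (k + 1) - h k) * m = ∑ j ∈ range m, (h (k + 1) - h k) := by simp; ring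
      _ ≤ ∑ j ∈ range m, (h (j + 1) - h j) :=
        sum_le_sum fun j hj ↦ hanti (by have := mem_range.1 hj; omega)
      _ = h m - h 0 := sum_range_sub h m
  induction t with
  | zero => simp
  | succ t ih =>
    have := hinc (m + t) (by omega)
    push_cast
    rw [← add_assoc]
    linarith

/-- Let `S` be a set of sequences indexed by the cyclic group generated by `g`. If the ends of every
arc of `m` steps determine the arc, then `#S ≤ n ^ (L / m)`, where `L` is the order of the group. -/
lemma card_le_rpow_of_ends_determine [Fintype V] {S : Finset (A → V)} {g : A} {m : ℕ} (hm : 0 < m)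
    (hmA : 2 * m ≤ Fintype.card A) (hg : ∀ a : A, ∃ j < Fintype.card A, j • g = a)
    (hS : ∀ x ∈ S, ∀ y ∈ S, ∀ i, y i = x i → y (i + m • g) = x (i + m • g) →
      ∀ j ≤ m, y (i + j • g) = x (i + j • g)) :
    (#S : ℝ) ≤ (Fintype.card V : ℝ) ^ ((Fintype.card A : ℝ) / m) := by
  set L := Fintype.card A with hL
  rcases S.eq_empty_or_nonempty with rfl | ⟨x₀, hx₀⟩
  · simp only [card_empty, Nat.cast_zero]
    positivity
  have hV : (0 : ℝ) < Fintype.card V := by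
    exact_mod_cast Fintype.card_pos_iff.2 ⟨x₀ 0⟩
  have hSpos : (0 : ℝ) < #S := by exact_mod_cast card_pos.2 ⟨x₀, hx₀⟩
  have hm' : (0 : ℝ) < m := by exact_mod_cast hm
  have hLpos : (0 : ℝ) < L := by exact_mod_cast (by omega : 0 < L)
  have hLg : L • g = 0 := by rw [hL]; exact card_nsmul_eq_zero
  have harc0 : ∀ i, arc g i 0 = {i} := fun i ↦ by simp [arc]
  -- entropy of single coordinates
  have h0 : arcEntropy S g 0 ≤ L * (#S * log (Fintype.card V)) := by
    simp only [arcEntropy, harc0]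
    refine (sum_le_card_nsmul univ _ _ fun i _ ↦ coordEntropy_singleton_le i).trans ?_
    rw [card_univ, nsmul_eq_mul]
  -- an arc of `m` steps has at most the entropy of its two ends
  have h1 : arcEntropy S g m ≤ 2 * arcEntropy S g 0 := by
    have hshift : arcEntropy S g 0 = ∑ i, coordEntropy S {i + m • g} := by
      simp only [arcEntropy, harc0]
      exact (Equiv.sum_comp (Equiv.addRight (m • g)) fun i ↦ coordEntropy S {i}).symm
    rw [two_mul]
    nth_rewrite 2 [hshift]
    simp only [arcEntropy, harc0]
    rw [← sum_add_distrib]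
    refine sum_le_sum fun i _ ↦ le_trans ?_ (coordEntropy_pair_le i (i + m • g))
    refine coordEntropy_le_of_determines fun x hx y hy hxy a ha ↦ ?_
    obtain ⟨j, hj, rfl⟩ := mem_arc.1 ha
    exact hS x hx y hy i (hxy i (by simp)) (hxy _ (by simp)) j hj
  -- the complementary arc determines everything
  have determined : ∀ i, ∀ x ∈ S, ∀ y ∈ S, (∀ a ∈ arc g i (L - m), y a = x a) → y = x := by
    intro i x hx y hy hxy
    funext a
    obtain ⟨j, hj, hja⟩ := hg (a - i)
    have ha : a = i + j • g := by rw [hja]; abel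
    rcases le_or_gt j (L - m) with hjm | hjm
    · exact hxy a (mem_arc.2 ⟨j, hjm, ha.symm⟩)
    · have := hS x hx y hy (i + (L - m) • g) (hxy _ (mem_arc.2 ⟨_, le_rfl, rfl⟩))
        (by
          rw [add_assoc, ← add_nsmul, Nat.sub_add_cancel (by omega), hLg, add_zero]
          exact hxy _ (mem_arc.2 ⟨0, by omega, by simp⟩)) (j - (L - m)) (by omega)
      rwa [add_assoc, ← add_nsmul, show L - m + (j - (L - m)) = j by omega, ← ha] at this
  have h2 : arcEntropy S g (L - m) = L * (#S * log #S) := by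
    rw [arcEntropy, sum_congr rfl fun i _ ↦ coordEntropy_eq_of_determines (determined i)]
    simp [hL]
  have h3 := le_chord_of_concave (arcEntropy_add_le S g) hm (L - 2 * m)
  rw [show m + (L - 2 * m) = L - m by omega, h2, Nat.cast_sub hmA] at h3
  push_cast at h3
  have h4 : L * (#S * log #S) ≤ L * (#S * ((L / m) * log (Fintype.card V))) := by
    have h5 : ((L : ℝ) - 2 * m) * ((arcEntropy S g m - arcEntropy S g 0) / m) ≤
        (L - 2 * m) * (L * (#S * log (Fintype.card V)) / m) := by
      have : (2 * m : ℝ) ≤ L := by exact_mod_cast hmA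
      refine mul_le_mul_of_nonneg_left ?_ (by linarith)
      gcongr
      linarith
    calc L * (#S * log #S) ≤ 2 * (L * (#S * log (Fintype.card V))) +
          (L - 2 * m) * (L * (#S * log (Fintype.card V)) / m) := by linarith
      _ = _ := by field_simp; ring
  have h6 : log #S ≤ L / m * log (Fintype.card V) :=
    le_of_mul_le_mul_left (le_of_mul_le_mul_left h4 hLpos) hSpos
  rw [← log_rpow hV] at h6
  exact (log_le_log_iff hSpos (by positivity)).1 h6

end Cyclic

namespace SimpleGraph

open Finset

variable {V : Type*} {G : SimpleGraph V}

/-! ### The upper bound -/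

/-- A sequence of consecutively adjacent vertices with `f j ≠ f (j + 2)` traces a non-backtracking
walk. The vertex `u` is there for the induction. -/
lemma exists_walk_getVert_eq (k : ℕ) :
    ∀ (f : ℕ → V), (∀ j, G.Adj (f j) (f (j + 1))) → (∀ j, f j ≠ f (j + 2)) → ∀ u, u ≠ f 1 →
      ∃ p : G.Walk (f 0) (f k), p.length = k ∧ (∀ j ≤ k, p.getVert j = f j) ∧
        (s(u, f 0) :: p.edges).IsChain (· ≠ ·) := by
  induction k with
  | zero => exact fun f _ _ u _ ↦ ⟨.nil, by simp⟩
  | succ k ih =>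
    intro f hadj hne u hu
    obtain ⟨p, h1, h2, h3⟩ := ih (fun j ↦ f (j + 1)) (fun j ↦ hadj _) (fun j ↦ hne _) (f 0) (hne 0)
    refine ⟨Walk.cons (hadj 0) p, by simp [h1], ?_, ?_⟩
    · rintro (_ | j) hj
      · simp
      · simpa using h2 j (by omega)
    · rw [Walk.edges_cons]
      refine List.IsChain.cons_cons ?_ h3
      rw [ne_eq, Sym2.eq_iff]
      rintro (⟨-, h⟩ | ⟨h, -⟩)
      · exact (hadj 0).ne h
      · exact hu h

lemma val_nsmul_one_fin (k j : ℕ) : (j • (1 : Fin (k + 2))).val = j % (k + 2) := by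
  induction j with
  | zero => simp
  | succ j ih => rw [succ_nsmul, Fin.val_add, ih]; simp

lemma labelledCopyCount_eq_card [Fintype V] {W : Type*} [Fintype W] (H : SimpleGraph W)
    [Fintype (Copy H G)] : G.labelledCopyCount H = #(univ : Finset (Copy H G)) := by
  classical
  rw [card_univ]
  unfold labelledCopyCount
  congr!

/-- A graph on `n` vertices with girth larger than `2 * m` has at most `n ^ (L / m)` cycles of
length `L`, for every `L ≥ 2 * m`. -/
lemma copyCount_cycleGraph_le [Fintype V] {m L : ℕ} (hm : 0 < m) (hL : 3 ≤ L) (hmL : 2 * m ≤ L)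
    (hG : ((2 * m : ℕ) : ℕ∞) < G.egirth) :
    (G.copyCount (cycleGraph L) : ℝ) ≤ (Fintype.card V : ℝ) ^ ((L : ℝ) / m) := by
  classical
  obtain ⟨k, rfl⟩ : ∃ k, L = k + 1 + 2 := ⟨L - 3, by omega⟩
  let S : Finset (Fin (k + 1 + 2) → V) :=
    (univ : Finset (Copy (cycleGraph (k + 1 + 2)) G)).image fun f i ↦ f i
  have hcard : G.labelledCopyCount (cycleGraph (k + 1 + 2)) = #S := by
    rw [card_image_of_injective _ fun f g h ↦ Copy.ext (congrFun h), labelledCopyCount_eq_card]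
  have hmain := card_le_rpow_of_ends_determine (S := S) (g := 1) hm (by simpa using hmL) ?_ ?_
  · rw [← hcard, Fintype.card_fin] at hmain
    refine le_trans ?_ hmain
    exact Nat.cast_le.2 copyCount_le_labelledCopyCount
  · intro a
    refine ⟨a.val, by simp, ?_⟩
    apply Fin.ext
    rw [val_nsmul_one_fin, Nat.mod_eq_of_lt a.isLt]
  · have hwalk : ∀ x ∈ S, ∀ i, ∃ p : G.Walk (x i) (x (i + m • 1)), p.length = m ∧
        (∀ j ≤ m, p.getVert j = x (i + j • 1)) ∧ p.edges.IsChain (· ≠ ·) := by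
      intro x hx i
      obtain ⟨f, -, rfl⟩ := mem_image.1 hx
      have hadj : ∀ j : ℕ, G.Adj (f (i + j • 1)) (f (i + (j + 1) • 1)) := by
        intro j
        refine f.toHom.map_adj (cycleGraph_adj.2 (Or.inr ?_))
        rw [succ_nsmul]
        abel
      have hne : ∀ j : ℕ, f (i + j • 1) ≠ f (i + (j + 2) • 1) := by
        intro j h
        have h := f.injective h
        rw [add_nsmul, ← add_assoc, left_eq_add] at h
        have h := congrArg Fin.val h
        rw [val_nsmul_one_fin, Nat.mod_eq_of_lt (by omega)] at h
        simp at h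
      obtain ⟨p, h1, h2, h3⟩ := exists_walk_getVert_eq m (fun j ↦ f (i + j • 1)) hadj hne
        (f (i + 0 • 1)) (hadj 0).ne
      refine ⟨p.copy (by simp) rfl, by simpa using h1, fun j hj ↦ by simpa using h2 j hj, ?_⟩
      rw [Walk.edges_copy]
      exact h3.of_cons
    intro x hx y hy i hi hi' j hj
    obtain ⟨p, hp, hp', hpc⟩ := hwalk x hx i
    obtain ⟨q, hq, hq', hqc⟩ := hwalk y hy i
    have := Walk.eq_of_isChain_edges hG (p := p) (q := q.copy hi hi') hpc (by simpa using hqc)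
      hp.le (by simpa using hq.le)
    rw [← hp' j hj, ← hq' j hj, this, Walk.getVert_copy]

/-! ### Cycles as closed walks -/

lemma labelledCopyCount_le_copyCount_mul [Fintype V] {W : Type*} [Fintype W] (H : SimpleGraph W) :
    G.labelledCopyCount H ≤ Fintype.card W ^ Fintype.card W * G.copyCount H := by
  classical
  rw [labelledCopyCount_eq_card, copyCount_eq_card_image_copyToSubgraph]
  refine card_le_mul_card_image _ _ fun B hB ↦ ?_
  obtain ⟨f, -, rfl⟩ := mem_image.1 hB
  -- a labelled copy with the same subgraph takes its values in the image of `f`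
  calc #{g ∈ (univ : Finset (Copy H G)) | g.toSubgraph = f.toSubgraph}
      ≤ #(Fintype.piFinset fun _ : W ↦ univ.image f) := by
        refine card_le_card_of_injOn (fun g ↦ ⇑g) ?_ (DFunLike.coe_injective.injOn)
        intro g hg
        simp only [coe_filter, mem_univ, true_and, Set.mem_ofPred_eq] at hg
        simp only [mem_coe, Fintype.mem_piFinset, mem_image, mem_univ, true_and]
        intro w
        have hw : g w ∈ g.toSubgraph.verts := by simp [Copy.toSubgraph]
        rw [hg] at hw
        simpa [Copy.toSubgraph] using hw
    _ = #(univ.image f) ^ Fintype.card W := by simp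
    _ ≤ Fintype.card W ^ Fintype.card W := Nat.pow_le_pow_left card_image_le _

open Classical in
/-- The walks of length `k` from `x` to `y`: `finsetWalkLength` with classical decidability, so
that no statement about it carries instances. -/
noncomputable def walksOfLength [Fintype V] (G : SimpleGraph V) (k : ℕ) (x y : V) :
    Finset (G.Walk x y) :=
  G.finsetWalkLength k x y

/-- The number of walks of length `k` from `x` to `y`. -/
noncomputable def numWalks [Fintype V] (G : SimpleGraph V) (k : ℕ) (x y : V) : ℕ :=
  #(G.walksOfLength k x y)

/-- The closed walks of length `L`, with their base points. -/
noncomputable def closedWalks [Fintype V] (G : SimpleGraph V) (L : ℕ) : Finset (Σ v, G.Walk v v) :=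
  univ.sigma fun v ↦ G.walksOfLength L v v

section

variable [Fintype V]

lemma mem_walksOfLength {k : ℕ} {x y : V} {p : G.Walk x y} :
    p ∈ G.walksOfLength k x y ↔ p.length = k := by
  simp [walksOfLength, mem_finsetWalkLength_iff]

lemma mem_closedWalks {L : ℕ} {t : Σ v, G.Walk v v} : t ∈ G.closedWalks L ↔ t.2.length = L := by
  simp [closedWalks, mem_walksOfLength]

lemma card_closedWalks (L : ℕ) : #(G.closedWalks L) = ∑ v, G.numWalks L v v := by
  simp [closedWalks, numWalks]

lemma numWalks_eq_pow [DecidableEq V] [DecidableRel G.Adj] (k : ℕ) (x y : V) :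
    (G.numWalks k x y : ℕ) = (G.adjMatrix ℕ ^ k) x y := by
  rw [adjMatrix_pow_apply_eq_card_walk, card_set_walk_length_eq, numWalks, walksOfLength,
    Nat.cast_id]
  congr!

lemma sum_numWalks_mul (i j : ℕ) (x y : V) :
    ∑ u, G.numWalks i x u * G.numWalks j u y = G.numWalks (i + j) x y := by
  classical
  simp only [numWalks_eq_pow, pow_add, Matrix.mul_apply]

lemma numWalks_symm (k : ℕ) (x y : V) : G.numWalks k x y = G.numWalks k y x := by
  classical
  rw [numWalks_eq_pow, numWalks_eq_pow, ← Matrix.transpose_apply (G.adjMatrix ℕ ^ k),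
    Matrix.transpose_pow, transpose_adjMatrix]

lemma numWalks_one [DecidableRel G.Adj] (x y : V) :
    G.numWalks 1 x y = if G.Adj x y then 1 else 0 := by
  classical
  rw [numWalks_eq_pow, pow_one, adjMatrix_apply]

lemma sum_numWalks_zero (x : V) : ∑ y, G.numWalks 0 x y = 1 := by
  classical
  simp [numWalks_eq_pow, Matrix.one_apply]

lemma sum_numWalks_succ [DecidableRel G.Adj] (k : ℕ) (x : V) :
    ∑ y, G.numWalks (k + 1) x y = ∑ w ∈ G.neighborFinset x, ∑ y, G.numWalks k w y := by
  simp_rw [add_comm k 1, ← sum_numWalks_mul 1 k]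
  rw [sum_comm]
  simp_rw [← mul_sum, numWalks_one, ite_mul, one_mul, zero_mul, ← sum_filter]
  congr 1
  ext w
  simp

lemma sum_numWalks_le [DecidableRel G.Adj] {Δ : ℝ} (hΔ : ∀ v, (G.degree v : ℝ) ≤ Δ)
    (k : ℕ) (x : V) : ((∑ y, G.numWalks k x y : ℕ) : ℝ) ≤ Δ ^ k := by
  induction k generalizing x with
  | zero => simp [sum_numWalks_zero]
  | succ k ih =>
    have h0 : 0 ≤ Δ := (Nat.cast_nonneg _).trans (hΔ x)
    rw [sum_numWalks_succ, Nat.cast_sum]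
    calc _ ≤ ∑ w ∈ G.neighborFinset x, Δ ^ k := sum_le_sum fun w _ ↦ ih w
      _ = G.degree x * Δ ^ k := by rw [sum_const, card_neighborFinset_eq_degree, nsmul_eq_mul]
      _ ≤ Δ * Δ ^ k := by gcongr; exact hΔ x
      _ = _ := by ring

lemma le_sum_numWalks [DecidableRel G.Adj] {δ : ℝ} {S : Finset V} (h0 : 0 ≤ δ)
    (hδ : ∀ v ∈ S, δ ≤ G.degree v) (hS : ∀ v ∈ S, ∀ w, G.Adj v w → w ∈ S)
    (k : ℕ) {x : V} (hx : x ∈ S) : δ ^ k ≤ ((∑ y, G.numWalks k x y : ℕ) : ℝ) := by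
  induction k generalizing x with
  | zero => simp [sum_numWalks_zero]
  | succ k ih =>
    rw [sum_numWalks_succ, Nat.cast_sum]
    calc δ ^ (k + 1) = δ * δ ^ k := by ring
      _ ≤ G.degree x * δ ^ k := by gcongr; exact hδ x hx
      _ = ∑ w ∈ G.neighborFinset x, δ ^ k := by
        rw [sum_const, card_neighborFinset_eq_degree, nsmul_eq_mul]
      _ ≤ _ := sum_le_sum fun w hw ↦ ih (hS x hx w (by simpa using hw))

/-- A closed walk of length `2 * ℓ` is a pair of walks of length `ℓ` with the same ends; the
Cauchy–Schwarz inequality over the pairs of ends gives the bound. -/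
lemma le_card_closedWalks [DecidableRel G.Adj] {δ : ℝ} {S : Finset V} (h0 : 0 ≤ δ)
    (hδ : ∀ v ∈ S, δ ≤ G.degree v) (hS : ∀ v ∈ S, ∀ w, G.Adj v w → w ∈ S) (ℓ : ℕ) :
    (#S * δ ^ ℓ) ^ 2 ≤ (Fintype.card V : ℝ) ^ 2 * #(G.closedWalks (2 * ℓ)) := by
  have h1 : (#S * δ ^ ℓ : ℝ) ≤ ∑ t : V × V, (G.numWalks ℓ t.1 t.2 : ℝ) := by
    rw [Fintype.sum_prod_type]
    calc (#S * δ ^ ℓ : ℝ) = ∑ x ∈ S, δ ^ ℓ := by rw [sum_const, nsmul_eq_mul]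
      _ ≤ ∑ x ∈ S, ∑ y, (G.numWalks ℓ x y : ℝ) := sum_le_sum fun x hx ↦ by
        simpa using le_sum_numWalks h0 hδ hS ℓ hx
      _ ≤ _ := sum_le_sum_of_subset_of_nonneg (subset_univ _) fun _ _ _ ↦ by positivity
  have h2 : (#(G.closedWalks (2 * ℓ)) : ℝ) = ∑ t : V × V, (G.numWalks ℓ t.1 t.2 : ℝ) ^ 2 := by
    rw [card_closedWalks, Fintype.sum_prod_type]
    push_cast
    refine sum_congr rfl fun x _ ↦ ?_
    rw [two_mul, ← sum_numWalks_mul]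
    push_cast
    exact sum_congr rfl fun y _ ↦ by rw [numWalks_symm ℓ y x, sq]
  rw [h2]
  calc (#S * δ ^ ℓ) ^ 2 ≤ (∑ t : V × V, (G.numWalks ℓ t.1 t.2 : ℝ)) ^ 2 := by gcongr
    _ ≤ _ := by
      have := sq_sum_le_card_mul_sum_sq (s := univ)
        (f := fun t : V × V ↦ (G.numWalks ℓ t.1 t.2 : ℝ))
      simpa [Fintype.card_prod, sq] using this

open Classical in
/-- The closed walks of length `L` that visit a vertex twice, other than by closing up. -/
noncomputable def degenerateWalks (G : SimpleGraph V) (L : ℕ) : Finset (Σ v, G.Walk v v) :=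
  {t ∈ G.closedWalks L | ∃ i j, i < j ∧ j < L ∧ t.2.getVert i = t.2.getVert j}

/-- A closed walk without repetitions parametrizes a labelled cycle. -/
lemma card_closedWalks_le {L : ℕ} (hL : 3 ≤ L) :
    #(G.closedWalks L) ≤ G.labelledCopyCount (cycleGraph L) + #(G.degenerateWalks L) := by
  classical
  rw [labelledCopyCount_eq_card]
  have hcopy : ∀ t ∈ G.closedWalks L \ G.degenerateWalks L,
      ∃ f : Copy (cycleGraph L) G, ∀ i, f i = t.2.getVert i.val := by
    obtain ⟨k, rfl⟩ : ∃ k, L = k + 1 + 2 := ⟨L - 3, by omega⟩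
    rintro ⟨v, p⟩ ht
    rw [mem_sdiff, degenerateWalks, mem_filter, not_and, mem_closedWalks] at ht
    obtain ⟨hp, hinj⟩ := ht
    have hinj := hinj hp
    push Not at hinj
    dsimp only at hp hinj ⊢
    have hsucc : ∀ a : Fin (k + 1 + 2), G.Adj (p.getVert a.val) (p.getVert (a + 1).val) := by
      intro a
      have ha := p.adj_getVert_succ (i := a.val) (by omega)
      rw [Fin.val_add_one]
      split_ifs with h
      · rw [h, Fin.val_last] at ha
        rw [h, Fin.val_last, p.getVert_zero]
        rwa [show k + 1 + 1 + 1 = p.length by omega, p.getVert_length] at ha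
      · exact ha
    refine ⟨⟨⟨fun i ↦ p.getVert i.val, ?_⟩, ?_⟩, fun _ ↦ rfl⟩
    · intro a b hab
      rcases cycleGraph_adj.1 hab with h | h
      · rw [sub_eq_iff_eq_add'] at h
        rw [h]
        exact (hsucc b).symm
      · rw [sub_eq_iff_eq_add'] at h
        rw [h]
        exact hsucc a
    · intro a b hab
      rcases lt_trichotomy a b with h | h | h
      · exact absurd hab (hinj a b h b.isLt)
      · exact h
      · exact absurd hab.symm (hinj b a h a.isLt)
  have h2 : #(G.closedWalks L \ G.degenerateWalks L) ≤ #(univ : Finset (Copy (cycleGraph L) G)) := by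
    refine card_le_card_of_forall_subsingleton (fun t f ↦ ∀ i, f i = t.2.getVert i.val)
      (fun t ht ↦ (hcopy t ht).imp fun f hf ↦ ⟨mem_univ _, hf⟩) ?_
    rintro f - ⟨v, p⟩ ⟨hp, hfp⟩ ⟨w, q⟩ ⟨hq, hfq⟩
    have h3 : ∀ i : Fin L, p.getVert i.val = q.getVert i.val := fun i ↦ (hfp i).symm.trans (hfq i)
    have hvw : v = w := by simpa using h3 ⟨0, by omega⟩
    subst hvw
    have hp' : p.length = L := mem_closedWalks.1 (mem_sdiff.1 hp).1
    have hq' : q.length = L := mem_closedWalks.1 (mem_sdiff.1 hq).1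
    congr 1
    refine Walk.ext_getVert_le_length (hp'.trans hq'.symm) fun i hi ↦ ?_
    rcases hi.lt_or_eq with hi | rfl
    · exact h3 ⟨i, hp' ▸ hi⟩
    · rw [p.getVert_length, hp', ← hq', q.getVert_length]
  have h3 := card_le_card_sdiff_add_card (s := G.closedWalks L) (t := G.degenerateWalks L)
  omega

end

/-! ### Walks in a graph of large girth and bounded degree -/

lemma Walk.exists_eq_append {x y : V} (p : G.Walk x y) :
    ∀ {i : ℕ}, i ≤ p.length → ∀ {u}, p.getVert i = u →
      ∃ (q : G.Walk x u) (r : G.Walk u y), p = q.append r ∧ q.length = i := by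
  induction p with
  | nil =>
    rintro i hi u rfl
    exact ⟨.nil, .nil, rfl, (Nat.le_zero.1 hi).symm⟩
  | @cons a b c h p ih =>
    rintro (_ | i) hi u hu
    · rw [Walk.getVert_zero] at hu
      subst hu
      exact ⟨.nil, .cons h p, rfl, rfl⟩
    · rw [Walk.getVert_cons_succ] at hu
      obtain ⟨q, r, rfl, h2⟩ := ih (i := i) (by simpa using hi) hu
      exact ⟨.cons h q, r, rfl, by simp [h2]⟩

/-- A walk either never backtracks or contains a step followed by its reverse. -/
lemma Walk.isChain_edges_or_exists_backtrack {x y : V} (p : G.Walk x y) :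
    p.edges.IsChain (· ≠ ·) ∨ ∃ (u w : V) (q : G.Walk x u) (h : G.Adj u w) (r : G.Walk u y),
      p = q.append (.cons h (.cons h.symm r)) := by
  induction p with
  | nil => simp
  | @cons a b c h p ih =>
    rcases ih with ih | ⟨u, w, q, h', r, rfl⟩
    · cases p with
      | nil => simp
      | @cons _ d _ h' r =>
        by_cases hd : d = a
        · subst hd
          exact Or.inr ⟨d, b, .nil, h, r, rfl⟩
        · left
          rw [Walk.edges_cons, Walk.edges_cons]
          refine List.IsChain.cons_cons ?_ (by rwa [Walk.edges_cons] at ih)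
          rw [ne_eq, Sym2.eq_iff]
          rintro (⟨rfl, -⟩ | ⟨rfl, -⟩)
          · exact h.ne rfl
          · exact hd rfl
    · exact Or.inr ⟨u, w, .cons h q, h', r, rfl⟩

section

variable [Fintype V]

open Classical in
/-- The non-backtracking walks of length `k` from `x` to `y`. -/
noncomputable def nonbacktrackingWalks (G : SimpleGraph V) (k : ℕ) (x y : V) :
    Finset (G.Walk x y) :=
  {p ∈ G.walksOfLength k x y | p.edges.IsChain (· ≠ ·)}

lemma mem_nonbacktrackingWalks {k : ℕ} {x y : V} {p : G.Walk x y} :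
    p ∈ G.nonbacktrackingWalks k x y ↔ p.length = k ∧ p.edges.IsChain (· ≠ ·) := by
  simp [nonbacktrackingWalks, mem_walksOfLength]

lemma card_nonbacktrackingWalks_le_one {m k : ℕ} (hG : ((2 * m : ℕ) : ℕ∞) < G.egirth)
    (hk : k ≤ m) (x y : V) : #(G.nonbacktrackingWalks k x y) ≤ 1 := by
  rw [card_le_one]
  intro p hp q hq
  rw [mem_nonbacktrackingWalks] at hp hq
  exact Walk.eq_of_isChain_edges hG hp.2 hq.2 (hp.1.trans_le hk) (hq.1.trans_le hk)

/-- A non-backtracking walk is determined by its end and everything before its last `m` steps. -/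
lemma card_nonbacktrackingWalks_le_sum {m : ℕ} (hG : ((2 * m : ℕ) : ℕ∞) < G.egirth)
    (k : ℕ) (x y : V) : #(G.nonbacktrackingWalks (k + m) x y) ≤ ∑ u, G.numWalks k x u := by
  classical
  let D : Finset (Σ u, G.Walk x u × G.Walk u y) :=
    univ.sigma fun u ↦ G.walksOfLength k x u ×ˢ G.nonbacktrackingWalks m u y
  calc #(G.nonbacktrackingWalks (k + m) x y) ≤ #(D.image fun t ↦ t.2.1.append t.2.2) := by
        refine card_le_card fun p hp ↦ ?_
        obtain ⟨hp, hpc⟩ := mem_nonbacktrackingWalks.1 hp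
        obtain ⟨u, hu⟩ : ∃ u, p.getVert k = u := ⟨_, rfl⟩
        obtain ⟨q, r, rfl, hq⟩ := p.exists_eq_append (by omega) hu
        refine mem_image.2 ⟨⟨u, q, r⟩, ?_, rfl⟩
        rw [Walk.edges_append] at hpc
        rw [Walk.length_append] at hp
        simp only [D, mem_sigma, mem_univ, true_and, mem_product, mem_walksOfLength,
          mem_nonbacktrackingWalks]
        exact ⟨hq, by omega, hpc.right_of_append⟩
    _ ≤ #D := card_image_le
    _ = ∑ u, G.numWalks k x u * #(G.nonbacktrackingWalks m u y) := by
        simp [D, numWalks]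
    _ ≤ ∑ u, G.numWalks k x u := sum_le_sum fun u _ ↦
        (Nat.mul_le_mul_left _ (card_nonbacktrackingWalks_le_one hG le_rfl u y)).trans_eq (mul_one _)

/-- Deleting a backtracking step shortens a walk by two. -/
lemma numWalks_add_two_le {d : ℕ} [DecidableRel G.Adj] (hd : ∀ v, G.degree v ≤ d) (k : ℕ)
    (x y : V) : G.numWalks (k + 2) x y ≤
      #(G.nonbacktrackingWalks (k + 2) x y) + (k + 1) * (d * G.numWalks k x y) := by
  classical
  let D : ℕ → Finset (Σ u, (G.Walk x u × G.Walk u y) × {w // G.Adj u w}) := fun i ↦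
    univ.sigma fun u ↦ (G.walksOfLength i x u ×ˢ G.walksOfLength (k - i) u y) ×ˢ univ
  let f : (Σ u, (G.Walk x u × G.Walk u y) × {w // G.Adj u w}) → G.Walk x y := fun t ↦
    t.2.1.1.append (.cons t.2.2.2 (.cons t.2.2.2.symm t.2.1.2))
  have hD : ∀ i ∈ range (k + 1), #((D i).image f) ≤ d * G.numWalks k x y := by
    intro i hi
    have hi : i ≤ k := by have := mem_range.1 hi; omega
    calc #((D i).image f) ≤ #(D i) := card_image_le
      _ = ∑ u, G.numWalks i x u * G.numWalks (k - i) u y * G.degree u := by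
        rw [card_sigma]
        refine sum_congr rfl fun u _ ↦ ?_
        have hu : Fintype.card {w // G.Adj u w} = G.degree u := by
          rw [← card_neighborSet_eq_degree]
          exact Fintype.card_congr (Equiv.refl _)
        rw [card_product, card_product, card_univ, hu, numWalks, numWalks]
      _ ≤ ∑ u, G.numWalks i x u * G.numWalks (k - i) u y * d := by
        gcongr with u _
        exact hd u
      _ = d * G.numWalks k x y := by
        rw [← sum_mul, sum_numWalks_mul, Nat.add_sub_cancel' hi, mul_comm]
  calc G.numWalks (k + 2) x y
      ≤ #(G.nonbacktrackingWalks (k + 2) x y ∪ (range (k + 1)).biUnion fun i ↦ (D i).image f) := by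
        refine card_le_card fun p hp ↦ ?_
        rw [mem_walksOfLength] at hp
        rw [mem_union, mem_nonbacktrackingWalks]
        rcases p.isChain_edges_or_exists_backtrack with h | ⟨u, w, q, h, r, rfl⟩
        · exact Or.inl ⟨hp, h⟩
        · right
          simp only [Walk.length_append, Walk.length_cons] at hp
          refine mem_biUnion.2 ⟨q.length, mem_range.2 (by omega),
            mem_image.2 ⟨⟨u, (q, r), ⟨w, h⟩⟩, ?_, rfl⟩⟩
          simp only [D, mem_sigma, mem_univ, true_and, mem_product, mem_walksOfLength,
            and_true]
          omega
    _ ≤ _ := by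
        refine (card_union_le _ _).trans (Nat.add_le_add_left ?_ _)
        refine (card_biUnion_le.trans (sum_le_card_nsmul _ _ _ hD)).trans_eq ?_
        simp

/-- In a graph of girth larger than `2 * m` with degrees at most `s ^ 2`, the number of walks of
length `k` between two vertices is `O(s ^ max k (2 * k - 2 * m))`: the extreme cases are the walks
that backtrack all the time and those that never do. The subtraction is truncated, which matches
the bound `1` for non-backtracking walks of length less than `m`. -/
lemma numWalks_le {m : ℕ} (hm : 1 ≤ m) (hG : ((2 * m : ℕ) : ℕ∞) < G.egirth)
    [DecidableRel G.Adj] {s : ℝ} (hs : 1 ≤ s) (hd : ∀ v, (G.degree v : ℝ) ≤ s ^ 2) (k : ℕ)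
    (x y : V) : (G.numWalks k x y : ℝ) ≤ (k + 1).factorial * s ^ max k (2 * k - 2 * m) := by
  classical
  have hnb : ∀ k, (#(G.nonbacktrackingWalks k x y) : ℝ) ≤ s ^ (2 * k - 2 * m) := by
    intro k
    rcases le_or_gt k m with hk | hk
    · calc (#(G.nonbacktrackingWalks k x y) : ℝ) ≤ 1 := by
            exact_mod_cast card_nonbacktrackingWalks_le_one hG hk x y
        _ ≤ _ := one_le_pow₀ hs
    · obtain ⟨j, rfl⟩ : ∃ j, k = j + m := ⟨k - m, by omega⟩
      calc (#(G.nonbacktrackingWalks (j + m) x y) : ℝ) ≤ ((∑ u, G.numWalks j x u : ℕ) : ℝ) := by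
            exact_mod_cast card_nonbacktrackingWalks_le_sum hG j x y
        _ ≤ (s ^ 2) ^ j := sum_numWalks_le hd j x
        _ = _ := by rw [← pow_mul]; congr 1; omega
  have hshort : ∀ k ≤ 1, (G.numWalks k x y : ℝ) ≤ (k + 1).factorial * s ^ max k (2 * k - 2 * m) := by
    intro k hk
    have h1 : G.numWalks k x y ≤ 1 := by
      refine le_trans (card_le_card fun p hp ↦ ?_)
        (card_nonbacktrackingWalks_le_one hG (hk.trans hm) x y)
      rw [mem_walksOfLength] at hp
      rw [mem_nonbacktrackingWalks]
      refine ⟨hp, ?_⟩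
      have : p.edges.length ≤ 1 := by rw [p.length_edges]; omega
      match h : p.edges with
      | [] => simp
      | [_] => simp
      | _ :: _ :: _ => simp [h] at this
    calc (G.numWalks k x y : ℝ) ≤ 1 * 1 := by rw [one_mul]; exact_mod_cast h1
      _ ≤ _ := by
        gcongr
        · exact_mod_cast Nat.one_le_iff_ne_zero.2 (Nat.factorial_ne_zero _)
        · exact one_le_pow₀ hs
  induction k using Nat.strong_induction_on with
  | _ k ih =>
  rcases le_or_gt k 1 with hk | hk
  · exact hshort k hk
  · obtain ⟨k, rfl⟩ : ∃ j, k = j + 2 := ⟨k - 2, by omega⟩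
    -- the degree bound rounded down to a natural number
    obtain ⟨d, hd1, hd2⟩ : ∃ d : ℕ, (∀ v, G.degree v ≤ d) ∧ (d : ℝ) ≤ s ^ 2 :=
      ⟨⌊s ^ 2⌋₊, fun v ↦ Nat.le_floor (hd v), Nat.floor_le (by positivity)⟩
    set E := max (k + 2) (2 * (k + 2) - 2 * m) with hE
    have h1 : (G.numWalks (k + 2) x y : ℝ) ≤ #(G.nonbacktrackingWalks (k + 2) x y) +
        (k + 1) * (d * G.numWalks k x y) := by
      exact_mod_cast numWalks_add_two_le hd1 k x y
    have h2 : (#(G.nonbacktrackingWalks (k + 2) x y) : ℝ) ≤ s ^ E :=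
      (hnb _).trans (pow_le_pow_right₀ hs (le_max_right _ _))
    have h3 : (d : ℝ) * G.numWalks k x y ≤ (k + 1).factorial * s ^ E := by
      calc (d : ℝ) * G.numWalks k x y
          ≤ s ^ 2 * ((k + 1).factorial * s ^ max k (2 * k - 2 * m)) := by
            gcongr
            exact ih k (by omega)
        _ = (k + 1).factorial * s ^ (max k (2 * k - 2 * m) + 2) := by ring
        _ ≤ _ := by
            gcongr
            omega
    have h4 : (1 : ℝ) + (k + 1) * (k + 1).factorial ≤ (k + 2 + 1).factorial := by
      have h5 : 1 ≤ (k + 1).factorial := Nat.one_le_iff_ne_zero.2 (Nat.factorial_ne_zero _)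
      have : 1 + (k + 1) * (k + 1).factorial ≤ (k + 2 + 1).factorial :=
        calc 1 + (k + 1) * (k + 1).factorial ≤ (k + 1 + 1) * (k + 1).factorial := by linarith
          _ = (k + 1 + 1).factorial := (Nat.factorial_succ _).symm
          _ ≤ _ := Nat.factorial_le (by omega)
      exact_mod_cast this
    calc (G.numWalks (k + 2) x y : ℝ) ≤ s ^ E + (k + 1) * ((k + 1).factorial * s ^ E) := by
          refine h1.trans (add_le_add h2 ?_)
          gcongr
      _ = (1 + (k + 1) * (k + 1).factorial) * s ^ E := by ring
      _ ≤ _ := by gcongr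

/-- A degenerate closed walk consists of two shorter closed walks with a common vertex. -/
lemma card_degenerateWalks_le_sum (L : ℕ) : #(G.degenerateWalks L) ≤
    ∑ t ∈ range L ×ˢ range L with t.1 < t.2,
      ∑ u, G.numWalks (t.2 - t.1) u u * G.numWalks (L - (t.2 - t.1)) u u := by
  classical
  let D : ℕ × ℕ → Finset (Σ v, Σ u, G.Walk v u × G.Walk u u × G.Walk u v) := fun t ↦
    univ.sigma fun v ↦ univ.sigma fun u ↦ G.walksOfLength t.1 v u ×ˢ
      G.walksOfLength (t.2 - t.1) u u ×ˢ G.walksOfLength (L - t.2) u v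
  let f : (Σ v, Σ u, G.Walk v u × G.Walk u u × G.Walk u v) → Σ v, G.Walk v v := fun t ↦
    ⟨t.1, t.2.2.1.append (t.2.2.2.1.append t.2.2.2.2)⟩
  have hsub : G.degenerateWalks L ⊆
      ((range L ×ˢ range L).filter fun t ↦ t.1 < t.2).biUnion fun t ↦ (D t).image f := by
    rintro ⟨v, p⟩ hp
    rw [degenerateWalks, mem_filter, mem_closedWalks] at hp
    obtain ⟨hp, i, j, hij, hjL, h⟩ := hp
    dsimp only at hp h
    obtain ⟨u, hu⟩ : ∃ u, p.getVert i = u := ⟨_, rfl⟩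
    obtain ⟨q, r, rfl, hq⟩ := p.exists_eq_append (by omega) hu
    rw [Walk.length_append] at hp
    have hr : r.getVert (j - i) = u := by
      rwa [h, Walk.getVert_append q r j, if_neg (by omega), hq] at hu
    obtain ⟨c, t, rfl, hc⟩ := r.exists_eq_append (i := j - i) (by omega) hr
    rw [Walk.length_append] at hp
    refine mem_biUnion.2 ⟨(i, j), ?_, mem_image.2 ⟨⟨v, u, q, c, t⟩, ?_, rfl⟩⟩
    · simp only [mem_filter, mem_product, mem_range]
      omega
    · simp only [D, mem_sigma, mem_univ, true_and, mem_product, mem_walksOfLength]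
      omega
  refine (card_le_card hsub).trans (card_biUnion_le.trans (sum_le_sum fun t ht ↦ ?_))
  simp only [mem_filter, mem_product, mem_range] at ht
  refine card_image_le.trans (le_of_eq ?_)
  calc #(D t) = ∑ v, ∑ u, G.numWalks t.1 v u *
        (G.numWalks (t.2 - t.1) u u * G.numWalks (L - t.2) u v) := by
        simp only [D, card_sigma, card_product, numWalks]
    _ = ∑ u, G.numWalks (t.2 - t.1) u u * G.numWalks (L - (t.2 - t.1)) u u := by
        rw [sum_comm]
        refine sum_congr rfl fun u _ ↦ ?_
        rw [show L - (t.2 - t.1) = (L - t.2) + t.1 by omega, ← sum_numWalks_mul, mul_sum]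
        exact sum_congr rfl fun v _ ↦ by ring

/-- Degenerate closed walks of length `2 * ℓ` are of lower order than the roughly `s ^ (4 * ℓ)`
closed walks that a graph with degrees of order `s ^ 2` and at most `s ^ (2 * m)` vertices has. -/
lemma card_degenerateWalks_le {m ℓ : ℕ} (hm : 1 ≤ m) (hmℓ : m < ℓ)
    (hG : ((2 * m : ℕ) : ℕ∞) < G.egirth) [DecidableRel G.Adj] {s : ℝ} (hs : 1 ≤ s)
    (hd : ∀ v, (G.degree v : ℝ) ≤ s ^ 2) (hV : (Fintype.card V : ℝ) ≤ s ^ (2 * m)) :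
    (#(G.degenerateWalks (2 * ℓ)) : ℝ) ≤
      ((2 * ℓ) ^ 2 * (2 * ℓ + 1).factorial ^ 2 : ℕ) * s ^ (4 * ℓ - 1) := by
  classical
  set C : ℝ := ((Nat.factorial (2 * ℓ + 1) : ℕ) : ℝ) with hC
  have hterm : ∀ t ∈ (range (2 * ℓ) ×ˢ range (2 * ℓ)).filter (fun t ↦ t.1 < t.2),
      ∑ u, (G.numWalks (t.2 - t.1) u u : ℝ) * G.numWalks (2 * ℓ - (t.2 - t.1)) u u ≤
        C ^ 2 * s ^ (4 * ℓ - 1) := by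
    rintro ⟨i, j⟩ ht
    simp only [mem_filter, mem_product, mem_range] at ht
    dsimp only
    obtain ⟨a, ha⟩ : ∃ a, a = j - i := ⟨_, rfl⟩
    obtain ⟨b, hb⟩ : ∃ b, b = 2 * ℓ - (j - i) := ⟨_, rfl⟩
    rw [← hb, ← ha]
    have hw : ∀ k ≤ 2 * ℓ, ∀ u, (G.numWalks k u u : ℝ) ≤ C * s ^ max k (2 * k - 2 * m) := by
      intro k hk u
      refine (numWalks_le hm hG hs hd k u u).trans ?_
      rw [hC]
      gcongr
    calc ∑ u, (G.numWalks a u u : ℝ) * G.numWalks b u u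
        ≤ ∑ u : V, (C * s ^ max a (2 * a - 2 * m)) * (C * s ^ max b (2 * b - 2 * m)) := by
          refine sum_le_sum fun u _ ↦ ?_
          gcongr
          · exact hw a (by omega) u
          · exact hw b (by omega) u
      _ = Fintype.card V * (C ^ 2 * s ^ (max a (2 * a - 2 * m) + max b (2 * b - 2 * m))) := by
          rw [sum_const, card_univ, nsmul_eq_mul]
          ring
      _ ≤ s ^ (2 * m) * (C ^ 2 * s ^ (max a (2 * a - 2 * m) + max b (2 * b - 2 * m))) := by
          gcongr
      _ = C ^ 2 * s ^ (2 * m + (max a (2 * a - 2 * m) + max b (2 * b - 2 * m))) := by ring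
      _ ≤ C ^ 2 * s ^ (4 * ℓ - 1) := by
          gcongr
          omega
  have h1 : (#(G.degenerateWalks (2 * ℓ)) : ℝ) ≤
      ∑ t ∈ range (2 * ℓ) ×ˢ range (2 * ℓ) with t.1 < t.2,
        ∑ u, (G.numWalks (t.2 - t.1) u u : ℝ) * G.numWalks (2 * ℓ - (t.2 - t.1)) u u := by
    exact_mod_cast card_degenerateWalks_le_sum (G := G) (2 * ℓ)
  refine h1.trans ((sum_le_card_nsmul _ _ _ hterm).trans ?_)
  have h2 : (#((range (2 * ℓ) ×ˢ range (2 * ℓ)).filter fun t ↦ t.1 < t.2) : ℝ) ≤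
      ((2 * ℓ) ^ 2 : ℕ) := by
    refine Nat.cast_le.2 ((card_filter_le _ _).trans_eq ?_)
    rw [card_product, card_range, sq]
  rw [nsmul_eq_mul]
  calc _ ≤ (((2 * ℓ) ^ 2 : ℕ) : ℝ) * (C ^ 2 * s ^ (4 * ℓ - 1)) := by gcongr
    _ = _ := by rw [hC]; push_cast; ring

end

/-! ### Almost regular subgraphs -/

section

variable [Fintype V]

open Classical in
/-- If the thresholds `f` add up to less than the number of edges, some subgraph `H`, living on a
nonempty set `S`, has degree at least `f v` at each `v ∈ S`. It suffices to let `S` maximize the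
number of induced edges minus the sum of the thresholds. -/
lemma exists_subgraph_le_degree (f : V → ℝ) (h : 2 * ∑ v, f v < ∑ v, (G.degree v : ℝ)) :
    ∃ H ≤ G, ∃ S : Finset V, S.Nonempty ∧ (∀ v ∈ S, ∀ w, H.Adj v w → w ∈ S) ∧
      ∀ v ∈ S, f v ≤ H.degree v := by
  let a : V → V → ℝ := fun u w ↦ if G.Adj u w then 1 else 0
  have ha : ∀ u w, a u w = a w u := fun u w ↦ by simp only [a, G.adj_comm]
  let Φ : Finset V → ℝ := fun S ↦ (∑ u ∈ S, ∑ w ∈ S, a u w) - 2 * ∑ v ∈ S, f v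
  obtain ⟨S, -, hS⟩ := exists_max_image (univ : Finset (Finset V)) Φ univ_nonempty
  have hpos : 0 < Φ S := by
    refine lt_of_lt_of_le ?_ (hS univ (mem_univ _))
    have : ∀ u, ∑ w, a u w = G.degree u := fun u ↦ by
      simp only [a, sum_boole, ← card_neighborFinset_eq_degree]
      congr 2
      ext w
      simp
    simp only [Φ, this]
    linarith
  obtain ⟨H, hH⟩ : ∃ H : SimpleGraph V, ∀ u w, H.Adj u w ↔ G.Adj u w ∧ u ∈ S ∧ w ∈ S :=
    ⟨{ Adj := fun u w ↦ G.Adj u w ∧ u ∈ S ∧ w ∈ S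
       symm := ⟨fun u w h ↦ ⟨h.1.symm, h.2.2, h.2.1⟩⟩
       loopless := ⟨fun u h ↦ G.loopless.irrefl u h.1⟩ }, fun _ _ ↦ Iff.rfl⟩
  refine ⟨H, fun u w h ↦ ((hH u w).1 h).1, S, ?_, fun v _ w h ↦ ((hH v w).1 h).2.2,
    fun v hv ↦ ?_⟩
  · rw [nonempty_iff_ne_empty]
    rintro rfl
    simp [Φ] at hpos
  · have hdeg : ∑ w ∈ S.erase v, a v w = H.degree v := by
      simp only [a, sum_boole, ← card_neighborFinset_eq_degree]
      congr 2
      ext w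
      simp only [mem_filter, mem_erase, mem_neighborFinset, hH]
      exact ⟨fun h ↦ ⟨h.2, hv, h.1.2⟩, fun h ↦ ⟨⟨h.1.ne', h.2.2⟩, h.1⟩⟩
    have h1 := hS (S.erase v) (mem_univ _)
    have h2 : Φ S = Φ (S.erase v) + 2 * ∑ w ∈ S.erase v, a v w - 2 * f v := by
      have hSv : S = insert v (S.erase v) := (insert_erase hv).symm
      have h3 : a v v = 0 := by simp [a]
      have h4 : ∑ u ∈ S.erase v, a u v = ∑ w ∈ S.erase v, a v w :=
        sum_congr rfl fun u _ ↦ ha u v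
      simp only [Φ]
      conv_lhs => rw [hSv]
      simp only [sum_insert (notMem_erase v S), sum_add_distrib, h3, h4]
      ring
    rw [hdeg] at h2
    linarith

/-- The Moore bound `degree_mul_pow_le_card` with a real lower bound on the degrees. -/
lemma degree_mul_pow_le_card_real {m : ℕ} (hm : 1 ≤ m) (hG : ((2 * m : ℕ) : ℕ∞) < G.egirth)
    [DecidableRel G.Adj] {S : Finset V} {d : ℝ} (hd : 2 ≤ d)
    (hdeg : ∀ v ∈ S, 2 * d ≤ G.degree v) (hS : ∀ v ∈ S, ∀ w, G.Adj v w → w ∈ S)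
    {v : V} (hv : v ∈ S) : (G.degree v : ℝ) * (d / 2) ^ (m - 1) ≤ #S := by
  obtain ⟨k, rfl⟩ : ∃ k, m = k + 1 := ⟨m - 1, by omega⟩
  have h1 : ∀ v ∈ S, ⌊d⌋₊ + 1 ≤ G.degree v := by
    intro v hv
    have h2 := hdeg v hv
    have h3 := Nat.floor_le (show 0 ≤ d by linarith)
    have : ((⌊d⌋₊ + 1 : ℕ) : ℝ) ≤ G.degree v := by push_cast; linarith
    exact_mod_cast this
  have h4 : d / 2 ≤ ⌊d⌋₊ := by
    have := Nat.lt_floor_add_one d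
    linarith
  calc (G.degree v : ℝ) * (d / 2) ^ (k + 1 - 1) ≤ G.degree v * (⌊d⌋₊ : ℝ) ^ k := by
        rw [Nat.add_sub_cancel]
        gcongr
    _ ≤ #S := by exact_mod_cast degree_mul_pow_le_card hG h1 hS hv

open Classical in
/-- A graph with at least `c * n * D` edges and girth larger than `2 * m`, where `n = D ^ m`, has a
subgraph in which all degrees are of order `D` and which lives on a positive proportion of the
vertices. Few edges touch vertices of degree at least `K * D`: otherwise the Moore bound, applied
around such a vertex in a subgraph of large minimum degree, would produce too many vertices. -/
lemma exists_almost_regular_subgraph {m : ℕ} (hm : 1 ≤ m) (hG : ((2 * m : ℕ) : ℕ∞) < G.egirth)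
    {c D K : ℝ} (hc : 0 < c) (hcD : 32 ≤ c * D) (hD : D ^ m = Fintype.card V) (hcK : c ≤ K)
    (hK : 1 < K / 8 * (c / 32) ^ (m - 1))
    (hE : 2 * (c * (Fintype.card V * D)) ≤ ∑ v, (G.degree v : ℝ)) :
    ∃ H ≤ G, ∃ S : Finset V, (∀ v ∈ S, ∀ w, H.Adj v w → w ∈ S) ∧
      (∀ v ∈ S, c * D / 8 ≤ H.degree v) ∧ (∀ v, (H.degree v : ℝ) ≤ K * D) ∧
      (c / 32) ^ m * Fintype.card V ≤ #S := by
  have hDpos : 0 < D := by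
    by_contra hneg
    push Not at hneg
    nlinarith
  have hn : (0 : ℝ) < Fintype.card V := by rw [← hD]; positivity
  have hKpos : 0 < K := hc.trans_le hcK
  obtain ⟨F, hF⟩ : ∃ F : SimpleGraph V, ∀ u w, F.Adj u w ↔
      G.Adj u w ∧ (K * D ≤ G.degree u ∨ K * D ≤ G.degree w) :=
    ⟨{ Adj := fun u w ↦ G.Adj u w ∧ (K * D ≤ G.degree u ∨ K * D ≤ G.degree w)
       symm := ⟨fun u w h ↦ ⟨h.1.symm, h.2.symm⟩⟩
       loopless := ⟨fun u h ↦ G.loopless.irrefl u h.1⟩ }, fun _ _ ↦ Iff.rfl⟩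
  obtain ⟨G₁, hG₁⟩ : ∃ G₁ : SimpleGraph V, ∀ u w, G₁.Adj u w ↔
      G.Adj u w ∧ ¬ (K * D ≤ G.degree u ∨ K * D ≤ G.degree w) :=
    ⟨{ Adj := fun u w ↦ G.Adj u w ∧ ¬ (K * D ≤ G.degree u ∨ K * D ≤ G.degree w)
       symm := ⟨fun u w h ↦ ⟨h.1.symm, fun h' ↦ h.2 h'.symm⟩⟩
       loopless := ⟨fun u h ↦ G.loopless.irrefl u h.1⟩ }, fun _ _ ↦ Iff.rfl⟩
  have hFG : F ≤ G := fun u w h ↦ ((hF u w).1 h).1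
  have hG₁G : G₁ ≤ G := fun u w h ↦ ((hG₁ u w).1 h).1
  have hdeg : ∀ v, F.degree v + G₁.degree v = G.degree v := by
    intro v
    simp only [← card_neighborFinset_eq_degree]
    rw [← card_union_of_disjoint]
    · congr 1
      ext w
      simp only [mem_union, mem_neighborFinset, hF, hG₁]
      tauto
    · rw [Finset.disjoint_left]
      intro w
      simp only [mem_neighborFinset, hF, hG₁]
      tauto
  have hFdeg : ∀ v, K * D ≤ G.degree v → F.degree v = G.degree v := by
    intro v hv
    simp only [← card_neighborFinset_eq_degree]
    congr 1
    ext w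
    simp only [mem_neighborFinset, hF]
    tauto
  have hsum : ∑ v, (F.degree v : ℝ) + ∑ v, (G₁.degree v : ℝ) = ∑ v, (G.degree v : ℝ) := by
    rw [← sum_add_distrib]
    exact sum_congr rfl fun v _ ↦ by exact_mod_cast hdeg v
  have hcnD : 0 < c * (Fintype.card V * D) := by positivity
  have hmoore : ∀ H ≤ G, ∀ S : Finset V, (∀ v ∈ S, c * D / 8 ≤ H.degree v) →
      (∀ v ∈ S, ∀ w, H.Adj v w → w ∈ S) → ∀ v ∈ S,
        (H.degree v : ℝ) * (c * D / 32) ^ (m - 1) ≤ #S := by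
    intro H hH S h1 h2 v hv
    have := degree_mul_pow_le_card_real hm (hG.trans_le (egirth_anti hH)) (d := c * D / 16)
      (by linarith) (fun v hv ↦ by have := h1 v hv; linarith) h2 hv
    rwa [show c * D / 16 / 2 = c * D / 32 by ring] at this
  have hpow : D * D ^ (m - 1) = Fintype.card V := by
    rw [← pow_succ', Nat.sub_add_cancel hm, hD]
  rcases lt_or_ge (∑ v, (G₁.degree v : ℝ)) (c * (Fintype.card V * D)) with hcase | hcase
  · exfalso
    have hFE : c * (Fintype.card V * D) ≤ ∑ v, (F.degree v : ℝ) := by linarith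
    let f : V → ℝ := fun v ↦ if K * D ≤ G.degree v then (F.degree v : ℝ) / 8 else c * D / 8
    have hf : 2 * ∑ v, f v < ∑ v, (F.degree v : ℝ) := by
      have h1 : ∑ v, f v ≤ ∑ v, ((F.degree v : ℝ) / 8 + c * D / 8) := by
        refine sum_le_sum fun v _ ↦ ?_
        simp only [f]
        split_ifs
        · have : 0 ≤ c * D / 8 := by positivity
          linarith
        · have : 0 ≤ (F.degree v : ℝ) / 8 := by positivity
          linarith
      rw [sum_add_distrib, ← sum_div, sum_const, card_univ, nsmul_eq_mul] at h1
      linarith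
    obtain ⟨H, hHF, S, ⟨v, hv⟩, hS, hdS⟩ := exists_subgraph_le_degree f hf
    have hlow : ∀ v ∈ S, c * D / 8 ≤ H.degree v := by
      intro v hv
      refine le_trans ?_ (hdS v hv)
      simp only [f]
      split_ifs with h
      · rw [hFdeg v h]
        have : c * D ≤ K * D := by gcongr
        linarith
      · exact le_rfl
    -- a vertex of `S` of degree at least `K * D / 8`
    obtain ⟨z, hz, hzd⟩ : ∃ z ∈ S, K * D ≤ G.degree z := by
      by_cases hvK : K * D ≤ G.degree v
      · exact ⟨v, hv, hvK⟩
      · have h1 : (0 : ℝ) < H.degree v := lt_of_lt_of_le (by positivity) (hlow v hv)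
        obtain ⟨w, hw⟩ := (H.degree_pos_iff_exists_adj v).1 (by exact_mod_cast h1)
        exact ⟨w, hS v hv w hw, ((hF v w).1 (hHF hw)).2.resolve_left hvK⟩
    have hzH : K * D / 8 ≤ H.degree z := by
      have := hdS z hz
      simp only [f, if_pos hzd, hFdeg z hzd] at this
      linarith
    have h1 : K * D / 8 * (c * D / 32) ^ (m - 1) ≤ Fintype.card V := by
      calc K * D / 8 * (c * D / 32) ^ (m - 1) ≤ H.degree z * (c * D / 32) ^ (m - 1) := by gcongr
        _ ≤ #S := hmoore H (hHF.trans hFG) S hlow hS z hz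
        _ ≤ Fintype.card V := by exact_mod_cast card_le_univ S
    have h2 : K * D / 8 * (c * D / 32) ^ (m - 1) =
        K / 8 * (c / 32) ^ (m - 1) * Fintype.card V := by
      rw [← hpow, show c * D / 32 = c / 32 * D by ring, mul_pow]
      ring
    rw [h2] at h1
    nlinarith
  · obtain ⟨H, hHG, S, ⟨v, hv⟩, hS, hdS⟩ := exists_subgraph_le_degree (G := G₁)
      (fun _ ↦ c * D / 4) (by
        rw [sum_const, card_univ, nsmul_eq_mul]
        refine lt_of_lt_of_le ?_ hcase
        linarith)
    have hlow : ∀ v ∈ S, c * D / 8 ≤ H.degree v := by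
      intro v hv
      refine le_trans ?_ (hdS v hv)
      linarith
    refine ⟨H, hHG.trans hG₁G, S, hS, hlow, fun v ↦ ?_, ?_⟩
    · by_cases hvK : K * D ≤ G.degree v
      · have : H.degree v = 0 := by
          by_contra hne
          obtain ⟨w, hw⟩ := (H.degree_pos_iff_exists_adj v).1 (Nat.pos_of_ne_zero hne)
          exact ((hG₁ v w).1 (hHG hw)).2 (Or.inl hvK)
        rw [this, Nat.cast_zero]
        positivity
      · have : H.degree v ≤ G.degree v := degree_le_of_le (hHG.trans hG₁G)
        have : (H.degree v : ℝ) ≤ G.degree v := by exact_mod_cast this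
        linarith
    · calc (c / 32) ^ m * Fintype.card V = c * D / 32 * (c * D / 32) ^ (m - 1) := by
            rw [← pow_succ', Nat.sub_add_cancel hm, ← hD]
            ring
        _ ≤ H.degree v * (c * D / 32) ^ (m - 1) := by
            gcongr
            have := hlow v hv
            linarith
        _ ≤ #S := hmoore H (hHG.trans hG₁G) S hlow hS v hv

lemma labelledCopyCount_mono {W : Type*} [Fintype W] {H : SimpleGraph V} (h : H ≤ G)
    (A : SimpleGraph W) : H.labelledCopyCount A ≤ G.labelledCopyCount A := by
  classical
  rw [labelledCopyCount_eq_card, labelledCopyCount_eq_card]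
  refine card_le_card_of_injOn (fun f ↦ (Copy.ofLE H G h).comp f) (fun _ _ ↦ mem_univ _) ?_
  intro f _ g _ hfg
  exact Copy.ext fun a ↦ DFunLike.congr_fun hfg a

end

/-! ### The lower bound -/

/-- The lower bound for a single length `2 * ℓ`, passing from closed walks in an almost regular
subgraph to cycles. Only walks without repeated vertices count, and these dominate once `D` exceeds
the threshold `T` of the proof. -/
lemma exists_mul_rpow_le_copyCount {c : ℝ} (hc : 0 < c) {m ℓ : ℕ} (hm : 1 ≤ m) (hmℓ : m < ℓ) :
    ∃ α : ℝ, 0 < α ∧ ∃ N : ℕ, ∀ (V : Type*) [Fintype V] (G : SimpleGraph V),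
      c * (Fintype.card V : ℝ) ^ (1 + 1 / (m : ℝ)) ≤ (G.edgeSet.ncard : ℝ) →
      ((2 * m : ℕ) : ℕ∞) < G.egirth → N ≤ Fintype.card V →
      α * (Fintype.card V : ℝ) ^ (2 * (ℓ : ℝ) / (m : ℝ)) ≤
        (G.copyCount (cycleGraph (2 * ℓ)) : ℝ) := by
  obtain ⟨K, hcK, hK1, hK⟩ : ∃ K, c ≤ K ∧ 1 ≤ K ∧ 1 < K / 8 * (c / 32) ^ (m - 1) := by
    refine ⟨c + 1 + 8 * ((c / 32) ^ (m - 1))⁻¹, ?_, ?_, ?_⟩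
    · have : 0 < 8 * ((c / 32) ^ (m - 1))⁻¹ := by positivity
      linarith
    · have : 0 < 8 * ((c / 32) ^ (m - 1))⁻¹ := by positivity
      linarith
    · have h1 : 0 < (c / 32) ^ (m - 1) := by positivity
      have h2 : (c + 1 + 8 * ((c / 32) ^ (m - 1))⁻¹) / 8 * (c / 32) ^ (m - 1) =
          (c + 1) / 8 * (c / 32) ^ (m - 1) + 1 := by
        field_simp
      rw [h2]
      have : 0 < (c + 1) / 8 * (c / 32) ^ (m - 1) := by positivity
      linarith
  -- `a * D ^ (2 * ℓ)` closed walks, of which `B * (K * D) ^ (2 * ℓ - 1 / 2)` may be degenerate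
  obtain ⟨a, ha⟩ : ∃ a : ℝ, a = (c / 32) ^ (2 * m) * (c / 8) ^ (2 * ℓ) := ⟨_, rfl⟩
  obtain ⟨B, hB⟩ : ∃ B : ℝ, B = (((2 * ℓ) ^ 2 * (2 * ℓ + 1).factorial ^ 2 : ℕ) : ℝ) := ⟨_, rfl⟩
  obtain ⟨Q, hQ⟩ : ∃ Q : ℝ, Q = (((2 * ℓ) ^ (2 * ℓ) : ℕ) : ℝ) := ⟨_, rfl⟩
  have hapos : 0 < a := by rw [ha]; positivity
  have hBpos : 0 ≤ B := hB ▸ Nat.cast_nonneg _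
  have hQpos : 0 < Q := by
    rw [hQ]
    exact_mod_cast pow_pos (by omega) _
  obtain ⟨T, hT⟩ : ∃ T : ℝ, T = 1 + 32 / c + (2 * B * K ^ (2 * ℓ) / a) ^ 2 := ⟨_, rfl⟩
  refine ⟨a / (2 * Q), by positivity, ⌈T ^ m⌉₊, ?_⟩
  intro V _ G hE hG hN
  classical
  set n := Fintype.card V with hn
  set D : ℝ := (n : ℝ) ^ (1 / (m : ℝ)) with hDdef
  have hm0 : (m : ℝ) ≠ 0 := by exact_mod_cast (by omega : m ≠ 0)
  have hT0 : 0 < T := by rw [hT]; positivity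
  have hTn : T ^ m ≤ n := (Nat.le_ceil _).trans (by exact_mod_cast hN)
  have hnpos : (0 : ℝ) < n := lt_of_lt_of_le (by positivity) hTn
  have hDm : D ^ m = n := by
    rw [hDdef, ← Real.rpow_natCast, ← Real.rpow_mul hnpos.le, one_div_mul_cancel hm0,
      Real.rpow_one]
  have hDpos : 0 < D := by positivity
  have hTD : T ≤ D := by
    refine le_of_pow_le_pow_left₀ (by omega : m ≠ 0) hDpos.le ?_
    rwa [hDm]
  have hD1 : 1 ≤ D := by
    refine le_trans ?_ hTD
    have : 0 < 32 / c := by positivity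
    have := sq_nonneg (2 * B * K ^ (2 * ℓ) / a)
    linarith
  have hcD : 32 ≤ c * D := by
    have h1 : 32 / c ≤ D := by
      refine le_trans ?_ hTD
      have := sq_nonneg (2 * B * K ^ (2 * ℓ) / a)
      linarith
    rwa [div_le_iff₀' hc] at h1
  have hE' : 2 * (c * (n * D)) ≤ ∑ v, (G.degree v : ℝ) := by
    have h1 : ∑ v, (G.degree v : ℝ) = 2 * (G.edgeSet.ncard : ℝ) := by
      rw [← coe_edgeFinset, Set.ncard_coe_finset]
      exact_mod_cast G.sum_degrees_eq_twice_card_edges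
    rw [h1, hDdef, ← Real.rpow_one_add' hnpos.le (by positivity)]
    linarith
  obtain ⟨H, hHG, S, hS, hlow, hup, hScard⟩ :=
    exists_almost_regular_subgraph hm hG hc hcD hDm hcK hK hE'
  have hHgirth := hG.trans_le (egirth_anti hHG)
  set s : ℝ := √(K * D) with hs
  have hs2 : s ^ 2 = K * D := Real.sq_sqrt (by positivity)
  have hKD : D ≤ K * D := le_mul_of_one_le_left hDpos.le hK1
  have hs1 : 1 ≤ s := Real.one_le_sqrt.2 (hD1.trans hKD)
  have hdegen : (#(H.degenerateWalks (2 * ℓ)) : ℝ) ≤ B * s ^ (4 * ℓ - 1) := by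
    rw [hB]
    refine card_degenerateWalks_le hm hmℓ hHgirth hs1 (fun v ↦ (hup v).trans_eq hs2.symm) ?_
    rw [pow_mul, hs2, ← hn, ← hDm]
    gcongr
  have hclosed : a * D ^ (2 * ℓ) ≤ #(H.closedWalks (2 * ℓ)) := by
    have h1 := le_card_closedWalks (δ := c * D / 8) (by positivity) hlow hS ℓ
    have h2 : a * D ^ (2 * ℓ) * (n : ℝ) ^ 2 = ((c / 32) ^ m * n * (c * D / 8) ^ ℓ) ^ 2 := by
      rw [ha]
      ring
    have h3 : ((c / 32) ^ m * n * (c * D / 8) ^ ℓ) ^ 2 ≤ (#S * (c * D / 8) ^ ℓ) ^ 2 := by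
      gcongr
    have h4 : a * D ^ (2 * ℓ) * (n : ℝ) ^ 2 ≤ #(H.closedWalks (2 * ℓ)) * (n : ℝ) ^ 2 := by
      rw [h2, mul_comm (#(H.closedWalks (2 * ℓ)) : ℝ)]
      exact h3.trans h1
    exact le_of_mul_le_mul_right h4 (by positivity)
  have hsmall : B * s ^ (4 * ℓ - 1) ≤ a / 2 * D ^ (2 * ℓ) := by
    have h1 : 2 * B * K ^ (2 * ℓ) / a ≤ s := by
      refine Real.le_sqrt_of_sq_le (le_trans ?_ (hTD.trans hKD))
      have : 0 < 32 / c := by positivity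
      linarith
    rw [div_le_iff₀ hapos] at h1
    have h2 : s ^ (4 * ℓ - 1) * s = K ^ (2 * ℓ) * D ^ (2 * ℓ) := by
      rw [← pow_succ, Nat.sub_add_cancel (by omega), ← mul_pow, ← hs2, ← pow_mul]
      congr 1
      ring
    have hspos : 0 < s := by linarith
    refine le_of_mul_le_mul_right ?_ hspos
    calc B * s ^ (4 * ℓ - 1) * s = B * (K ^ (2 * ℓ) * D ^ (2 * ℓ)) := by rw [mul_assoc, h2]
      _ = (2 * B * K ^ (2 * ℓ)) * D ^ (2 * ℓ) / 2 := by ring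
      _ ≤ (s * a) * D ^ (2 * ℓ) / 2 := by gcongr
      _ = a / 2 * D ^ (2 * ℓ) * s := by ring
  have hlab : a / 2 * D ^ (2 * ℓ) ≤ (G.labelledCopyCount (cycleGraph (2 * ℓ)) : ℝ) := by
    have h1 : (#(H.closedWalks (2 * ℓ)) : ℝ) ≤
        H.labelledCopyCount (cycleGraph (2 * ℓ)) + #(H.degenerateWalks (2 * ℓ)) := by
      exact_mod_cast card_closedWalks_le (G := H) (L := 2 * ℓ) (by omega)
    have h2 : (H.labelledCopyCount (cycleGraph (2 * ℓ)) : ℝ) ≤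
        G.labelledCopyCount (cycleGraph (2 * ℓ)) := by
      exact Nat.cast_le.2 (labelledCopyCount_mono hHG (cycleGraph (2 * ℓ)))
    linarith
  have hcopy : (G.labelledCopyCount (cycleGraph (2 * ℓ)) : ℝ) ≤
      Q * G.copyCount (cycleGraph (2 * ℓ)) := by
    have := labelledCopyCount_le_copyCount_mul (G := G) (cycleGraph (2 * ℓ))
    rw [Fintype.card_fin] at this
    rw [hQ]
    exact_mod_cast this
  have hDn : (n : ℝ) ^ (2 * (ℓ : ℝ) / (m : ℝ)) = D ^ (2 * ℓ) := by
    rw [hDdef, ← Real.rpow_natCast, ← Real.rpow_mul hnpos.le]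
    congr 1
    push_cast
    ring
  rw [hDn]
  refine le_of_mul_le_mul_left ?_ hQpos
  calc Q * (a / (2 * Q) * D ^ (2 * ℓ)) = a / 2 * D ^ (2 * ℓ) := by field_simp
    _ ≤ _ := hlab.trans hcopy

end SimpleGraph

theorem theorem1 (c : ℝ) (hc : 0 < c) (m M : ℕ) (hm : 2 ≤ m) (hmM : m < M) :
    ∃ α : ℝ, 0 < α ∧ ∃ β : ℝ, 0 < β ∧ ∃ N : ℕ,
      ∀ (V : Type*) [Fintype V] (G : SimpleGraph V) (n : ℕ),
        Fintype.card V = n →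
        c * (n : ℝ) ^ (1 + 1 / (m : ℝ)) ≤ (G.edgeSet.ncard : ℝ) →
        ((2 * m : ℕ) : ℕ∞) < G.egirth →
        N ≤ n →
        ∀ ℓ : ℕ, m + 1 ≤ ℓ → ℓ ≤ M →
          α * (n : ℝ) ^ (2 * (ℓ : ℝ) / (m : ℝ))
              ≤ (G.copyCount (SimpleGraph.cycleGraph (2 * ℓ)) : ℝ) ∧
            (G.copyCount (SimpleGraph.cycleGraph (2 * ℓ)) : ℝ)
              ≤ β * (n : ℝ) ^ (2 * (ℓ : ℝ) / (m : ℝ)) := by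
  choose! α hα N hN using fun (ℓ : ℕ) (h : m < ℓ) ↦
    SimpleGraph.exists_mul_rpow_le_copyCount hc (by omega : 1 ≤ m) h
  have hne : (Finset.Ioc m M).Nonempty := ⟨M, by simp [hmM]⟩
  refine ⟨(Finset.Ioc m M).inf' hne α, ?_, 1, one_pos, (Finset.Ioc m M).sup N, ?_⟩
  · rw [Finset.lt_inf'_iff]
    exact fun ℓ hℓ ↦ hα ℓ (Finset.mem_Ioc.1 hℓ).1
  · rintro V _ G n rfl hE hG hn ℓ hmℓ hℓM
    have hℓ : ℓ ∈ Finset.Ioc m M := Finset.mem_Ioc.2 ⟨hmℓ, hℓM⟩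
    constructor
    · refine le_trans ?_ (hN ℓ hmℓ V G hE hG ((Finset.le_sup hℓ).trans hn))
      gcongr
      exact Finset.inf'_le α hℓ
    · rw [one_mul]
      have := SimpleGraph.copyCount_cycleGraph_le (G := G) (m := m) (L := 2 * ℓ) (by omega)
        (by omega) (by omega) hG
      push_cast at this
      exact this
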